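/- **Theorem 4.1.** *Setting.* Let $t>1$ and, for $\nu=0,1,t$, let $z_\nu,\theta_\nu,u_\nu\in\mathbb R$ with $u_\nu\neq 0$, $$W_\nu=\begin{bmatrix} z_\nu+\theta_\nu/2 & -u_\nu z_\nu\\ u_\nu^{-1}(z_\nu+\theta_\nu)& -z_\nu-\theta_\nu/2\end{bmatrix},\qquad J=\begin{bmatrix}0&-1\\1&0\end{bmatrix}.$$ Let $\Phi:(t,\infty)\to\mathbb R^2$ be a bounded solution of the linear equation $\frac{d\Phi}{d\lambda}=\bigl(\frac{W_0}{\lambda}+\frac{W_1}{\lambda-1}+\frac{W_t}{\lambda-t}\bigr)\Phi$ of the $P_{VI}$ Lax pair with $\int_t^\infty\lambda^{-1}\|\Phi(\lambda)\|^2d\lambda<\infty$, and let $K$ be the $P_{VI}$ kernel $$K(\lambda,\mu)=\frac{\langle J\Phi(\lambda),\Phi(\mu)\rangle}{\lambda-\mu},$$ extended continuously to $\lambda=\mu$. Let $V_\nu$ be real $2\times2$ matrices with $JW_\nu=V_\nu^\dagger\,\mathrm{diag}(1,-1)\,V_\nu$, let $\phi(\lambda)\in\mathbb R^6$ be the vector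 with blocks $V_\nu\Phi(\lambda)/(\lambda-\nu)$ ($\nu=0,1,t$), coordinates permuted so that the three first components come before the three second ones, and let $\sigma=\sigma_{3,3}=\mathrm{diag}(I_3,-I_3)$ (so that $K=\Gamma_\phi^\dagger\sigma\Gamma_\phi$, where $\Gamma_\phi$ is the Hankel operator with kernel $\phi(\lambda+\mu)$). For $y>t$ let $\tau_K(y)=\det(I-P_{(y,\infty)}K)$ be the Fredholm determinant of the integral operator with kernel $K$ on $L^2(y,\infty)$. Let $a\ge t/2$ (for instance $a=t$) and let $(-A,B,C)$ be a linear system with separable complex Hilbert state space $H$ that realises $\phi$: $(e^{-sA})_{s\ge0}$ is a $C_0$-semigroup on $H$, and for $s>a$ one has $e^{-sA}B\in H$, the operator $Ce^{-sA}:H\to\mathbb C^6$ is bounded, with $e^{-rA}(e^{-sA}B)=e^{-(r+s)A}B$ and $(Ce^{-sA})e^{-rA}=Ce^{-(s+r)A}$ for $r\ge 0$, and $\phi(x+y)=Ce^{-xA}e^{-yA}B$ for $x,y>a$. Suppose that for every $x>a$ the Gramians $$L_x=\int_x^\infty e^{-sA}BB^\dagger e^{-sA^\dagger}ds,\qquad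 Q_x^\sigma=\int_x^\infty e^{-sA^\dagger}C^\dagger\sigma Ce^{-sA}\,ds$$ exist as weakly convergent operator integrals and are trace class operators of norm less than one. *Conclusion.* For $x,y>a$ the operators $I-L_xQ_x^\sigma$ and $I-Q_x^\sigma L_x$ are invertible, and the $(6+1)\times(6+1)$ block matrix $G(x,y)=\begin{bmatrix}U&V\\T&\zeta\end{bmatrix}(x,y)$ with $$U=Ce^{-xA}(I-L_xQ_x^\sigma)^{-1}L_xe^{-yA^\dagger}C^\dagger\sigma,\qquad V=-Ce^{-xA}(I-L_xQ_x^\sigma)^{-1}e^{-yA}B,$$ $$T=-B^\dagger e^{-xA^\dagger}(I-Q_x^\sigma L_x)^{-1}e^{-yA^\dagger}C^\dagger,\qquad \zeta=B^\dagger e^{-xA^\dagger}(I-Q_x^\sigma L_x)^{-1}Q_x^\sigma e^{-yA}B$$ satisfies the Gelfand–Levitan equation $$G(x,y)+\begin{bmatrix}0&\phi(x+y)\\ \phi(x+y)^\dagger&0\end{bmatrix}+\int_x^\infty G(x,w)\ast\begin{bmatrix}0&\phi(w+y)\\ \phi(w+y)^\dagger&0\end{bmatrix}dw=0,$$ where the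 integral converges absolutely and $$\begin{bmatrix}U&V\\T&\zeta\end{bmatrix}\ast\begin{bmatrix}0&\phi\\ \phi^\dagger&0\end{bmatrix}=\begin{bmatrix}V\phi^\dagger\sigma&U\phi\\ \zeta\phi^\dagger&T\sigma\phi\end{bmatrix}.$$ Moreover, for every $x>a$ the Fredholm series of $\tau_K(2x)=\det(I-P_{(2x,\infty)}K)$ converges absolutely, $\tau_K(2x)>0$, and $$\frac{d}{dx}\log\tau_K(2x)=\operatorname{trace}G(x,x).$$ -/

import Mathlib

open MeasureTheory Set Matrix
open scoped InnerProductSpace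

noncomputable section

/-! ### Trace class operators, weak integrals, Fredholm determinants -/

/-- Trace class (equivalently, nuclear) operators on a Hilbert space: `T` is an absolutely
convergent sum of rank one operators `h ↦ ⟪v n, h⟫ • u n`. -/
def IsTraceClass {H : Type*} [NormedAddCommGroup H] [InnerProductSpace ℂ H]
    (T : H →L[ℂ] H) : Prop :=
  ∃ u v : ℕ → H, Summable (fun n => ‖u n‖ * ‖v n‖) ∧
    ∀ h, HasSum (fun n => ⟪v n, h⟫_ℂ • u n) (T h)

/-- `T = ∫_x^∞ F(s) ds` as a weakly convergent operator integral. -/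
def IsOperatorIntegral {H : Type*} [NormedAddCommGroup H] [InnerProductSpace ℂ H]
    (F : ℝ → H →L[ℂ] H) (x : ℝ) (T : H →L[ℂ] H) : Prop :=
  ∀ h k : H, IntegrableOn (fun s => ⟪k, F s h⟫_ℂ) (Ioi x) ∧
    ⟪k, T h⟫_ℂ = ∫ s in Ioi x, ⟪k, F s h⟫_ℂ

/-- The Fredholm minor `det [k(x_i, x_j)]`. -/
def fredholmMinor (k : ℝ → ℝ → ℝ) {n : ℕ} (x : Fin n → ℝ) : ℝ :=
  (Matrix.of fun i j => k (x i) (x j)).det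

/-- The `n`-fold product of Lebesgue measure on `X`. -/
def powMeasure (X : Set ℝ) (n : ℕ) : Measure (Fin n → ℝ) :=
  Measure.pi fun _ => volume.restrict X

/-- The Fredholm series of `det (I - K)`, for the integral operator `K` on `L²(X)` with the
kernel `k`, converges absolutely. -/
def FredholmConverges (k : ℝ → ℝ → ℝ) (X : Set ℝ) : Prop :=
  (∀ n : ℕ, Integrable (fredholmMinor k (n := n)) (powMeasure X n)) ∧
    Summable fun n : ℕ => (n.factorial : ℝ)⁻¹ * ∫ x, |fredholmMinor k (n := n) x| ∂(powMeasure X n)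

/-- The Fredholm determinant `det (I - K)` of the integral operator `K` on `L²(X)` with the
kernel `k`, namely `∑ₙ (-1)ⁿ / n! ∫_{Xⁿ} det [k(x_i, x_j)] dx`. -/
def fredholmDet (k : ℝ → ℝ → ℝ) (X : Set ℝ) : ℝ :=
  ∑' n : ℕ, (-1) ^ n * (n.factorial : ℝ)⁻¹ * ∫ x, fredholmMinor k (n := n) x ∂(powMeasure X n)

/-! ### The linear system of Painlevé VI and its kernel -/

/-- The parameters, at a fixed value `t > 1` of the deformation variable, of the `λ`-equation of
the Lax pair of Painlevé VI. The indices `0, 1, 2` stand for the finite singular points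
`0, 1, t`. -/
structure PVIParams where
  t : ℝ
  one_lt_t : 1 < t
  z : Fin 3 → ℝ
  θ : Fin 3 → ℝ
  u : Fin 3 → ℝ
  u_ne_zero : ∀ ν, u ν ≠ 0

namespace PVIParams

/-- The finite singular points `0, 1, t`. -/
def pole (p : PVIParams) : Fin 3 → ℝ := ![0, 1, p.t]

/-- The residue matrices `W_ν`. -/
def W (p : PVIParams) (ν : Fin 3) : Matrix (Fin 2) (Fin 2) ℝ :=
  !![p.z ν + p.θ ν / 2, -(p.u ν * p.z ν);
     (p.u ν)⁻¹ * (p.z ν + p.θ ν), -p.z ν - p.θ ν / 2]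

/-- `W_0 / x + W_1 / (x - 1) + W_t / (x - t)`. -/
def coeff (p : PVIParams) (x : ℝ) : Matrix (Fin 2) (Fin 2) ℝ :=
  ∑ ν, (x - p.pole ν)⁻¹ • p.W ν

/-- The skew-symmetric matrix `J`. -/
def J : Matrix (Fin 2) (Fin 2) ℝ := !![0, -1; 1, 0]

/-- `Φ` is a bounded real solution on `(t, ∞)` of `dΦ/dx = (∑_ν W_ν / (x - ν)) Φ` such that
`∫_t^∞ ‖Φ(x)‖² dx / x < ∞`. -/
structure IsSolution (p : PVIParams) (Φ : ℝ → Fin 2 → ℝ) : Prop where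
  ode : ∀ x, p.t < x → HasDerivAt Φ (p.coeff x *ᵥ Φ x) x
  bounded : ∃ M, ∀ x, p.t < x → ‖Φ x‖ ≤ M
  integrable : IntegrableOn (fun x => x⁻¹ * (Φ x ⬝ᵥ Φ x)) (Ioi p.t)

/-- The kernel `K(x, y) = ⟨J Φ(x), Φ(y)⟩ / (x - y)`, continued to the diagonal by continuity,
where its value is `⟨J Φ'(x), Φ(x)⟩`. -/
def kernel (p : PVIParams) (Φ : ℝ → Fin 2 → ℝ) (x y : ℝ) : ℝ :=
  if x = y then (J *ᵥ (p.coeff x *ᵥ Φ x)) ⬝ᵥ Φ x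
  else ((J *ᵥ Φ x) ⬝ᵥ Φ y) / (x - y)

/-- The `τ` function `τ_K(x) = det (I - P_{(x,∞)} K)`. -/
def tau (p : PVIParams) (Φ : ℝ → Fin 2 → ℝ) (x : ℝ) : ℝ :=
  fredholmDet (p.kernel Φ) (Ioi x)

/-- Real matrices `V_ν` with `J W_ν = V_ν† σ_{1,1} V_ν`. -/
def IsFactorization (p : PVIParams) (V : Fin 3 → Matrix (Fin 2) (Fin 2) ℝ) : Prop :=
  ∀ ν, J * p.W ν = (V ν)ᵀ * !![1, 0; 0, -1] * V ν

/-- The `6`-vector `φ(x)` that stacks the vectors `V_ν Φ(x) / (x - ν)`, with the first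
components of the three vectors listed before the second components. -/
def symbol (p : PVIParams) (V : Fin 3 → Matrix (Fin 2) (Fin 2) ℝ) (Φ : ℝ → Fin 2 → ℝ) (x : ℝ) :
    Fin 3 ⊕ Fin 3 → ℝ :=
  Sum.elim (fun ν => (V ν *ᵥ Φ x) 0 / (x - p.pole ν)) (fun ν => (V ν *ᵥ Φ x) 1 / (x - p.pole ν))

end PVIParams

/-- The signature matrix `σ_{3,3} = diag (I_3, -I_3)`. -/
def sigma33 : Matrix (Fin 3 ⊕ Fin 3) (Fin 3 ⊕ Fin 3) ℂ := fromBlocks 1 0 0 (-1)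

/-- `σ_{3,3}` as an operator on `ℂ⁶`. -/
def sigmaOp : EuclideanSpace ℂ (Fin 3 ⊕ Fin 3) →L[ℂ] EuclideanSpace ℂ (Fin 3 ⊕ Fin 3) :=
  Matrix.toEuclideanCLM (n := Fin 3 ⊕ Fin 3) (𝕜 := ℂ) sigma33

/-! ### Linear systems -/

/-- A linear system `(-A, B, C)` with state space `H`, input space `ℂ` and output space `ℂ⁶`:
`-A` generates the `C₀`-semigroup `expA s = e^{-sA}`. The operators `B` and `C` need not be
bounded, and `B` need not take its values in `H`; they enter only through
`expAB s = e^{-sA} B ∈ H` and `CexpA s = C e^{-sA} : H → ℂ⁶` for `s > a`. -/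
structure LinearSystem (a : ℝ) (H : Type*) [NormedAddCommGroup H] [InnerProductSpace ℂ H] where
  expA : ℝ → H →L[ℂ] H
  expA_zero : expA 0 = 1
  expA_add : ∀ r s, 0 ≤ r → 0 ≤ s → expA (r + s) = expA r * expA s
  expA_cont : ∀ h, ContinuousOn (fun s => expA s h) (Ici 0)
  expAB : ℝ → H
  expAB_add : ∀ r s, 0 ≤ r → a < s → expAB (r + s) = expA r (expAB s)
  CexpA : ℝ → H →L[ℂ] EuclideanSpace ℂ (Fin 3 ⊕ Fin 3)
  CexpA_add : ∀ r s, 0 ≤ r → a < s → CexpA (s + r) = (CexpA s).comp (expA r)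

namespace LinearSystem

variable {a : ℝ} {H : Type*} [NormedAddCommGroup H] [InnerProductSpace ℂ H] [CompleteSpace H]

/-- The system realises `φ` on `(2a, ∞)`: `φ(x + y) = C e^{-xA} e^{-yA} B` for `x, y > a`. -/
def Realises (s : LinearSystem a H) (φ : ℝ → Fin 3 ⊕ Fin 3 → ℝ) : Prop :=
  ∀ x y, a < x → a < y → ∀ i, s.CexpA x (s.expAB y) i = (φ (x + y) i : ℂ)

/-- `L = L_x = ∫_x^∞ e^{-sA} B B† e^{-sA†} ds`. -/
def IsL (sys : LinearSystem a H) (x : ℝ) (L : H →L[ℂ] H) : Prop :=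
  IsOperatorIntegral (fun s => InnerProductSpace.rankOne ℂ (sys.expAB s) (sys.expAB s)) x L

/-- `Q = Q_x^σ = ∫_x^∞ e^{-sA†} C† σ_{3,3} C e^{-sA} ds`. -/
def IsQsigma (sys : LinearSystem a H) (x : ℝ) (Q : H →L[ℂ] H) : Prop :=
  IsOperatorIntegral
    (fun s => (ContinuousLinearMap.adjoint (sys.CexpA s)).comp (sigmaOp.comp (sys.CexpA s))) x Q

/-- The `(6+1) × (6+1)` block matrix
`U(x,y) =  C e^{-xA} (I - L Q)⁻¹ L e^{-yA†} C† σ`,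
`V(x,y) = -C e^{-xA} (I - L Q)⁻¹ e^{-yA} B`,
`T(x,y) = -B† e^{-xA†} (I - Q L)⁻¹ e^{-yA†} C†`,
`ζ(x,y) =  B† e^{-xA†} (I - Q L)⁻¹ Q e^{-yA} B`, where `L = L_x` and `Q = Q_x^σ`. -/
def G (sys : LinearSystem a H) (L Q : ℝ → H →L[ℂ] H) (x y : ℝ) :
    Matrix ((Fin 3 ⊕ Fin 3) ⊕ Unit) ((Fin 3 ⊕ Fin 3) ⊕ Unit) ℂ :=
  fromBlocks
    ((Matrix.of fun i j =>
      sys.CexpA x (Ring.inverse (1 - L x * Q x) (L x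
        (ContinuousLinearMap.adjoint (sys.CexpA y) (EuclideanSpace.single j 1)))) i) * sigma33)
    (Matrix.of fun i _ => -(sys.CexpA x (Ring.inverse (1 - L x * Q x) (sys.expAB y)) i))
    (Matrix.of fun _ j => -⟪sys.expAB x, Ring.inverse (1 - Q x * L x)
        (ContinuousLinearMap.adjoint (sys.CexpA y) (EuclideanSpace.single j 1))⟫_ℂ)
    (Matrix.of fun _ _ => ⟪sys.expAB x, Ring.inverse (1 - Q x * L x) (Q x (sys.expAB y))⟫_ℂ)

end LinearSystem

/-! ### The Gelfand–Levitan equation -/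

/-- The block matrix `[[0, φ], [φ†, 0]]`. -/
def offDiag (φ : Fin 3 ⊕ Fin 3 → ℝ) :
    Matrix ((Fin 3 ⊕ Fin 3) ⊕ Unit) ((Fin 3 ⊕ Fin 3) ⊕ Unit) ℂ :=
  fromBlocks 0 (Matrix.of fun i _ => (φ i : ℂ)) (Matrix.of fun i _ => (φ i : ℂ))ᴴ 0

/-- The signature-twisted product
`[[U, V], [T, ζ]] ∗ [[0, φ], [φ†, 0]] = [[V φ† σ, U φ], [ζ φ†, T σ φ]]`. -/
def starProd (G Φ : Matrix ((Fin 3 ⊕ Fin 3) ⊕ Unit) ((Fin 3 ⊕ Fin 3) ⊕ Unit) ℂ) :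
    Matrix ((Fin 3 ⊕ Fin 3) ⊕ Unit) ((Fin 3 ⊕ Fin 3) ⊕ Unit) ℂ :=
  fromBlocks (G.toBlocks₁₂ * Φ.toBlocks₂₁ * sigma33) (G.toBlocks₁₁ * Φ.toBlocks₁₂)
    (G.toBlocks₂₂ * Φ.toBlocks₂₁) (G.toBlocks₂₁ * sigma33 * Φ.toBlocks₁₂)

/-- `G(x,y) + Φ(x+y) + ∫_x^∞ G(x,w) ∗ Φ(w+y) dw = 0`, with an absolutely convergent integral,
for `Φ = [[0, φ], [φ†, 0]]`. -/
def GelfandLevitanAt (φ : ℝ → Fin 3 ⊕ Fin 3 → ℝ)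
    (G : ℝ → ℝ → Matrix ((Fin 3 ⊕ Fin 3) ⊕ Unit) ((Fin 3 ⊕ Fin 3) ⊕ Unit) ℂ) (x y : ℝ) : Prop :=
  ∀ i j, IntegrableOn (fun w => starProd (G x w) (offDiag (φ (w + y))) i j) (Ioi x) ∧
    G x y i j + offDiag (φ (x + y)) i j +
      ∫ w in Ioi x, starProd (G x w) (offDiag (φ (w + y))) i j = 0

end

/-!
The kernel factors through the state space. From the Lax pair and `J W_ν = V_ν† diag (1, -1) V_ν`
one gets `(∂/∂x + ∂/∂y) K(x, y) = -φ(x)† σ φ(y)`, and `K` vanishes at infinity along lines of slope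
one, so `K(l, m) = ∫_x^∞ φ(w + l - x)† σ φ(w + m - x) dw`. Since the system realises `φ`, this is
`⟨b(l - x), Q_x b(m - x)⟩` for `l, m > 2x`, where `b(s) = e^{-sA} B` (`kernel_eq_inner`).

The Fredholm determinant of a kernel `⟨b(s), Q b(s')⟩` is computed from its definition as a series
of minors. `L = ∫ b b†` is trace class, which gives `∫ ‖b‖² < ∞`
(`integrable_norm_sq_of_isTraceClass`), and Hadamard's inequality then makes the series converge.
The classical recursion for the first Fredholm minors, here with values in `H`
(`vectorCoeff_succ`), gives `d/dt log det (I - t L Q) = -tr (L Q (I - t L Q)⁻¹)`. As `‖L Q‖ < 1`,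
the resolvent exists for `0 ≤ t ≤ 1`, hence `τ_K(2x) = exp (-∫₀¹ tr (L_x Q_x (I - t L_x Q_x)⁻¹) dt)`
(`gramDet_one_eq_exp`, `ofReal_tau`). The exponent is real because `L_x` and `Q_x` are
self-adjoint, so `τ_K(2x) > 0`.

The exponent can be differentiated in `x` although `L_x` and `Q_x` are only weak integrals: weak
derivatives with bounded difference quotients obey the product rule and the rule for inverses
(`HasWeakDerivAt`), and can be traced against `b b†`. The derivative of the trace is expressed by
`(I - t L Q)⁻²`, whose integral over `[0, 1]` is `(I - L Q)⁻¹`, and the result is minus the trace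
of `G(x, x)` (`hasDerivAt_integral_gramTrace_resolvent`, `trace_G`).

The Gelfand–Levitan equation is algebra: the integral of each entry of `G ∗ Φ` is a matrix entry of
`L_x` or `Q_x`, and the equation is the resolvent identity `N = I + N L Q`
(`gelfandLevitanAt`).
-/

noncomputable section

/-! ### Hadamard's inequality -/

open scoped ComplexOrder in
/-- A complex matrix whose rows are unit vectors has determinant of modulus at most one: the
eigenvalues `l` of `A Aᴴ` satisfy `l ≤ exp (l - 1)`, and they sum to the size of `A`. -/
theorem norm_det_le_one_of_unit_rows {n : Type*} [Fintype n] [DecidableEq n]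
    (A : Matrix n n ℂ) (hA : ∀ i, ∑ k, ‖A i k‖ ^ 2 = 1) : ‖A.det‖ ≤ 1 := by
  have hP : (A * Aᴴ).PosSemidef := Matrix.posSemidef_self_mul_conjTranspose A
  have htr : (A * Aᴴ).trace = (Fintype.card n : ℂ) := by
    have hd : ∀ i, (A * Aᴴ) i i = 1 := fun i => by
      have := congrArg (fun r : ℝ => (r : ℂ)) (hA i)
      simp only [Complex.ofReal_sum, Complex.ofReal_pow, Complex.ofReal_one] at this
      rw [Matrix.mul_apply, ← this]
      refine Finset.sum_congr rfl fun k _ => ?_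
      rw [conjTranspose_apply, RCLike.star_def, Complex.mul_conj']
    simp [Matrix.trace, hd]
  have hdet : (A * Aᴴ).det = ((‖A.det‖ ^ 2 : ℝ) : ℂ) := by
    rw [det_mul, det_conjTranspose, RCLike.star_def, Complex.mul_conj']
    push_cast; rfl
  rw [hP.isHermitian.det_eq_prod_eigenvalues] at hdet
  rw [hP.isHermitian.trace_eq_sum_eigenvalues] at htr
  have hdet' : ∏ i, hP.isHermitian.eigenvalues i = ‖A.det‖ ^ 2 :=
    Complex.ofReal_injective (by rw [← hdet, Complex.ofReal_prod]; rfl)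
  have htr' : ∑ i, hP.isHermitian.eigenvalues i = Fintype.card n :=
    Complex.ofReal_injective (by rw [Complex.ofReal_natCast, ← htr, Complex.ofReal_sum]; rfl)
  have h1 : ‖A.det‖ ^ 2 ≤ 1 := by
    rw [← hdet']
    calc ∏ i, hP.isHermitian.eigenvalues i
        ≤ ∏ i, Real.exp (hP.isHermitian.eigenvalues i - 1) :=
          Finset.prod_le_prod (fun i _ => hP.eigenvalues_nonneg i) fun i _ => by
            have := Real.add_one_le_exp (hP.isHermitian.eigenvalues i - 1); linarith
      _ = 1 := by rw [← Real.exp_sum]; simp [htr']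
  nlinarith [norm_nonneg A.det]

/-- Hadamard's inequality. -/
theorem norm_det_le_prod_of_rows {n : Type*} [Fintype n] [DecidableEq n]
    (A : Matrix n n ℂ) (r : n → ℝ) (hr : ∀ i, 0 ≤ r i) (hA : ∀ i, ∑ k, ‖A i k‖ ^ 2 ≤ r i ^ 2) :
    ‖A.det‖ ≤ ∏ i, r i := by
  set ρ : n → ℝ := fun i => √(∑ k, ‖A i k‖ ^ 2)
  have hρr : ∀ i, ρ i ≤ r i := fun i => Real.sqrt_le_iff.2 ⟨hr i, hA i⟩
  have hρ2 : ∀ i, ρ i ^ 2 = ∑ k, ‖A i k‖ ^ 2 := fun i =>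
    Real.sq_sqrt (Finset.sum_nonneg fun _ _ => by positivity)
  refine le_trans ?_ (Finset.prod_le_prod (fun i _ => Real.sqrt_nonneg _) fun i _ => hρr i)
  by_cases h0 : ∃ i, ρ i = 0
  · obtain ⟨i, hi⟩ := h0
    have hs := hρ2 i
    rw [hi, zero_pow two_ne_zero, eq_comm, Finset.sum_eq_zero_iff_of_nonneg
      (fun _ _ => by positivity)] at hs
    rw [det_eq_zero_of_row_eq_zero i fun k => by simpa using hs k (Finset.mem_univ k), norm_zero]
    exact Finset.prod_nonneg fun i _ => Real.sqrt_nonneg _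
  · push Not at h0
    have hpos : ∀ i, 0 < ρ i := fun i => lt_of_le_of_ne (Real.sqrt_nonneg _) (h0 i).symm
    have hB := norm_det_le_one_of_unit_rows
      (Matrix.of fun i k => ((ρ i : ℂ))⁻¹ * A i k) fun i => by
        simp only [of_apply, norm_mul, norm_inv, Complex.norm_real, Real.norm_eq_abs,
          abs_of_pos (hpos i), mul_pow]
        rw [← Finset.mul_sum, ← hρ2, inv_pow, inv_mul_cancel₀ (pow_ne_zero _ (h0 i))]
    rw [det_mul_column, norm_mul, norm_prod] at hB
    simp only [norm_inv, Complex.norm_real, Real.norm_eq_abs, fun i => abs_of_pos (hpos i),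
      Finset.prod_inv_distrib] at hB
    rwa [inv_mul_le_iff₀ (Finset.prod_pos fun i _ => hpos i), mul_one] at hB

/-- Hadamard's inequality for a matrix of inner products: factor it through an orthonormal basis
of the span of the `g j`. -/
theorem norm_det_inner_le {H : Type*} [NormedAddCommGroup H] [InnerProductSpace ℂ H]
    {n : Type*} [Fintype n] [DecidableEq n] (f g : n → H) :
    ‖(Matrix.of fun i j => ⟪f i, g j⟫_ℂ).det‖ ≤ (∏ i, ‖f i‖) * ∏ i, ‖g i‖ := by
  by_cases hg : LinearIndependent ℂ g
  · let S := Submodule.span ℂ (range g)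
    have : FiniteDimensional ℂ S := FiniteDimensional.span_of_finite ℂ (finite_range g)
    have hdim : Module.finrank ℂ S = Fintype.card n := finrank_span_eq_card hg
    let e : OrthonormalBasis n ℂ S := (stdOrthonormalBasis ℂ S).reindex
      (Fintype.equivOfCardEq (by simp [hdim]))
    have heo : Orthonormal ℂ (fun k => (e k : H)) := e.orthonormal.comp_linearIsometry S.subtypeₗᵢ
    have hgS : ∀ j, g j ∈ S := fun j => Submodule.subset_span (mem_range_self j)
    have hexp : ∀ j, g j = ∑ k, ⟪(e k : H), g j⟫_ℂ • (e k : H) := fun j => by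
      have := congrArg (Subtype.val) (e.sum_repr' ⟨g j, hgS j⟩)
      simp only [Submodule.coe_sum, Submodule.coe_smul, Submodule.coe_inner] at this
      exact this.symm
    have hfac : (Matrix.of fun i j => ⟪f i, g j⟫_ℂ) =
        (Matrix.of fun i k => ⟪f i, (e k : H)⟫_ℂ) * (Matrix.of fun j k => ⟪(e k : H), g j⟫_ℂ)ᵀ := by
      ext i j
      simp only [of_apply, mul_apply, transpose_apply]
      conv_lhs => rw [hexp j, inner_sum]
      exact Finset.sum_congr rfl fun k _ => by rw [inner_smul_right, mul_comm]
    rw [hfac, det_mul, det_transpose, norm_mul]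
    gcongr
    · refine norm_det_le_prod_of_rows _ _ (fun _ => norm_nonneg _) fun i => ?_
      simp only [of_apply, norm_inner_symm (f i)]
      exact heo.sum_inner_products_le (f i)
    · refine norm_det_le_prod_of_rows _ _ (fun _ => norm_nonneg _) fun i => ?_
      exact heo.sum_inner_products_le (g i)
  · rw [Fintype.not_linearIndependent_iff] at hg
    obtain ⟨c, hc, i, hi⟩ := hg
    have : (Matrix.of fun i j => ⟪f i, g j⟫_ℂ) *ᵥ c = 0 := by
      ext i
      have h2 := congrArg (fun v => ⟪f i, v⟫_ℂ) hc
      simp only [inner_sum, inner_smul_right, inner_zero_right] at h2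
      simpa [mulVec, dotProduct, mul_comm] using h2
    rw [Matrix.exists_mulVec_eq_zero_iff.1 ⟨c, fun h => hi (by simp [h]), this⟩, norm_zero]
    positivity

/-! ### Fredholm minors of a kernel `⟪b s, Q b s'⟫` -/

section Minors

variable {α : Type*} {H : Type*} [NormedAddCommGroup H] [InnerProductSpace ℂ H]

/-- The Fredholm minor of the kernel `⟪b s, Q b s'⟫`. -/
def gramMinor (b : α → H) (Q : H →L[ℂ] H) {n : ℕ} (s : Fin n → α) : ℂ :=
  (Matrix.of fun i j => ⟪b (s i), Q (b (s j))⟫_ℂ).det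

/-- The first Fredholm minor with values in `H`: the determinant, expanded along its first row, of
the matrix with first row `b s₀, b s₁, …, b sₙ` and further rows `⟪b sᵢ, Q b sⱼ⟫`, where
`0 ≤ j ≤ n` and `1 ≤ i ≤ n`. -/
def vectorMinor (b : α → H) (Q : H →L[ℂ] H) {n : ℕ} (s₀ : α) (s : Fin n → α) : H :=
  ∑ j : Fin (n + 1), ((-1) ^ (j : ℕ) * (Matrix.of fun i k : Fin n =>
    ⟪b (s i), Q (b ((Fin.cons s₀ s : Fin (n + 1) → α) (j.succAbove k)))⟫_ℂ).det) •
      b ((Fin.cons s₀ s : Fin (n + 1) → α) j)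

theorem cons_succ_succAbove {n : ℕ} (s₀ : α) (s : Fin (n + 1) → α) (j : Fin (n + 1))
    (k : Fin (n + 1)) :
    (Fin.cons s₀ s : Fin (n + 2) → α) (j.succ.succAbove k) =
      (Fin.cons s₀ (fun i => s (j.succAbove i)) : Fin (n + 1) → α) k := by
  refine Fin.cases ?_ (fun k => ?_) k
  · simp
  · rw [Fin.succ_succAbove_succ, Fin.cons_succ, Fin.cons_succ]

/-- Expansion of the vector-valued minor along the first row, where the cofactor of `b sⱼ` is
expanded further along the row of `sⱼ`. -/
theorem vectorMinor_succ (b : α → H) (Q : H →L[ℂ] H) {n : ℕ} (s₀ : α) (s : Fin (n + 1) → α) :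
    vectorMinor b Q s₀ s = gramMinor b Q s • b s₀ -
      ∑ j, ⟪b (s j), Q (vectorMinor b Q s₀ fun i => s (j.succAbove i))⟫_ℂ • b (s j) := by
  rw [vectorMinor, Fin.sum_univ_succ, sub_eq_add_neg, ← Finset.sum_neg_distrib]
  congr 1
  · simp [gramMinor]
  · refine Finset.sum_congr rfl fun j _ => ?_
    rw [Fin.cons_succ, ← neg_smul]
    congr 1
    rw [det_succ_row _ j, vectorMinor, map_sum, inner_sum, Finset.mul_sum,
      ← Finset.sum_neg_distrib]
    refine Finset.sum_congr rfl fun k _ => ?_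
    have hsub : (Matrix.of fun i k : Fin (n + 1) => ⟪b (s i),
          Q (b ((Fin.cons s₀ s : Fin (n + 2) → α) (j.succ.succAbove k)))⟫_ℂ).submatrix
          j.succAbove k.succAbove =
        Matrix.of fun i k' : Fin n => ⟪b (s (j.succAbove i)), Q (b ((Fin.cons s₀
          (fun i => s (j.succAbove i)) : Fin (n + 1) → α) (k.succAbove k')))⟫_ℂ := by
      ext i k'
      simp only [submatrix_apply, of_apply, cons_succ_succAbove]
    rw [hsub, of_apply, cons_succ_succAbove, map_smul, inner_smul_right, Fin.val_succ,
      pow_succ, pow_add]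
    have h1 : ((-1 : ℂ) ^ (j : ℕ)) * (-1) ^ (j : ℕ) = 1 := by rw [← mul_pow]; simp
    linear_combination (-(-1 : ℂ) ^ (k : ℕ) * ⟪b (s j), Q (b ((Fin.cons s₀
          (fun i => s (j.succAbove i)) : Fin (n + 1) → α) k))⟫_ℂ * (Matrix.of fun i k' : Fin n =>
        ⟪b (s (j.succAbove i)), Q (b ((Fin.cons s₀
          (fun i => s (j.succAbove i)) : Fin (n + 1) → α) (k.succAbove k')))⟫_ℂ).det) * h1

variable [CompleteSpace H]

/-- Pairing the vector-valued minor with `h` puts `⟪h, b sⱼ⟫` into the first row. -/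
theorem inner_vectorMinor (b : α → H) (Q : H →L[ℂ] H) {n : ℕ} (s₀ : α) (s : Fin n → α) (h : H) :
    ⟪h, vectorMinor b Q s₀ s⟫_ℂ = (Matrix.of fun i j : Fin (n + 1) =>
      ⟪(Fin.cons h fun i => ContinuousLinearMap.adjoint Q (b (s i)) : Fin (n + 1) → H) i,
        b ((Fin.cons s₀ s : Fin (n + 1) → α) j)⟫_ℂ).det := by
  rw [det_succ_row_zero, vectorMinor, inner_sum]
  refine Finset.sum_congr rfl fun j _ => ?_
  rw [inner_smul_right, of_apply, Fin.cons_zero]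
  have : (Matrix.of fun i j : Fin (n + 1) =>
      ⟪(Fin.cons h fun i => ContinuousLinearMap.adjoint Q (b (s i)) : Fin (n + 1) → H) i,
        b ((Fin.cons s₀ s : Fin (n + 1) → α) j)⟫_ℂ).submatrix Fin.succ j.succAbove =
      Matrix.of fun i k : Fin n =>
        ⟪b (s i), Q (b ((Fin.cons s₀ s : Fin (n + 1) → α) (j.succAbove k)))⟫_ℂ := by
    ext i k
    simp [ContinuousLinearMap.adjoint_inner_left]
  rw [this]
  ring

theorem gramMinor_cons (b : α → H) (Q : H →L[ℂ] H) {n : ℕ} (s₀ : α) (s : Fin n → α) :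
    gramMinor b Q (Fin.cons s₀ s : Fin (n + 1) → α) = ⟪b s₀, Q (vectorMinor b Q s₀ s)⟫_ℂ := by
  rw [← ContinuousLinearMap.adjoint_inner_left, inner_vectorMinor, gramMinor]
  congr 1
  ext i j
  refine Fin.cases ?_ (fun i => ?_) i <;> simp [ContinuousLinearMap.adjoint_inner_left]

omit [CompleteSpace H] in
theorem norm_gramMinor_le (b : α → H) (Q : H →L[ℂ] H) {n : ℕ} (s : Fin n → α) :
    ‖gramMinor b Q s‖ ≤ ∏ i, ‖Q‖ * ‖b (s i)‖ ^ 2 := by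
  refine (norm_det_inner_le (fun i => b (s i)) fun i => Q (b (s i))).trans ?_
  rw [← Finset.prod_mul_distrib]
  refine Finset.prod_le_prod (fun i _ => by positivity) fun i _ => ?_
  nlinarith [Q.le_opNorm (b (s i)), norm_nonneg (b (s i))]

/-- Hadamard's inequality for the vector-valued minor, from its pairing with itself. -/
theorem norm_vectorMinor_le (b : α → H) (Q : H →L[ℂ] H) {n : ℕ} (s₀ : α) (s : Fin n → α) :
    ‖vectorMinor b Q s₀ s‖ ≤ ‖b s₀‖ * ∏ i, ‖Q‖ * ‖b (s i)‖ ^ 2 := by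
  set v := vectorMinor b Q s₀ s with hv
  have h1 : ‖v‖ ^ 2 ≤ ‖v‖ * (‖b s₀‖ * ∏ i, ‖Q‖ * ‖b (s i)‖ ^ 2) := by
    have h2 : ‖v‖ ^ 2 = ‖⟪v, vectorMinor b Q s₀ s⟫_ℂ‖ := by
      rw [← hv, inner_self_eq_norm_sq_to_K]; simp
    rw [h2, inner_vectorMinor]
    refine (norm_det_inner_le _ _).trans ?_
    rw [Fin.prod_univ_succ, Fin.prod_univ_succ]
    simp only [Fin.cons_zero, Fin.cons_succ]
    have h3 : (∏ i, ‖ContinuousLinearMap.adjoint Q (b (s i))‖) * ∏ i, ‖b (s i)‖ ≤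
        ∏ i, ‖Q‖ * ‖b (s i)‖ ^ 2 := by
      rw [← Finset.prod_mul_distrib]
      refine Finset.prod_le_prod (fun i _ => by positivity) fun i _ => ?_
      have := (ContinuousLinearMap.adjoint Q).le_opNorm (b (s i))
      rw [LinearIsometryEquiv.norm_map] at this
      nlinarith [norm_nonneg (b (s i))]
    calc ‖v‖ * (∏ i, ‖ContinuousLinearMap.adjoint Q (b (s i))‖) * (‖b s₀‖ * ∏ i, ‖b (s i)‖)
        = ‖v‖ * (‖b s₀‖ * ((∏ i, ‖ContinuousLinearMap.adjoint Q (b (s i))‖) *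
            ∏ i, ‖b (s i)‖)) := by ring
      _ ≤ _ := by gcongr
  by_cases h0 : ‖v‖ = 0
  · rw [h0]; positivity
  · have : 0 < ‖v‖ := lt_of_le_of_ne (norm_nonneg _) (Ne.symm h0)
    rw [pow_two] at h1
    exact le_of_mul_le_mul_left h1 this

end Minors

/-! ### Integrated minors and their recursion -/

section Integrals

variable {α : Type*} [MeasurableSpace α] {μ : Measure α} [SigmaFinite μ]
  {H : Type*} [NormedAddCommGroup H] [InnerProductSpace ℂ H]
  {b : α → H} {Q L : H →L[ℂ] H}

/-- The integral of the Fredholm minor over `αⁿ`. -/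
def gramCoeff (μ : Measure α) (b : α → H) (Q : H →L[ℂ] H) (n : ℕ) : ℂ :=
  ∫ s : Fin n → α, gramMinor b Q s ∂Measure.pi fun _ => μ

/-- The integral of the vector-valued first Fredholm minor over all points but the first. -/
def vectorCoeff (μ : Measure α) (b : α → H) (Q : H →L[ℂ] H) (n : ℕ) (s₀ : α) : H :=
  ∫ s : Fin n → α, vectorMinor b Q s₀ s ∂Measure.pi fun _ => μ

omit [InnerProductSpace ℂ H] in
theorem aestronglyMeasurable_comp_eval (hb : AEStronglyMeasurable b μ) {n : ℕ} (i : Fin n) :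
    AEStronglyMeasurable (fun s : Fin n → α => b (s i)) (Measure.pi fun _ => μ) :=
  hb.comp_quasiMeasurePreserving (Measure.quasiMeasurePreserving_eval _ i)

theorem aestronglyMeasurable_det {β : Type*} [MeasurableSpace β] {ν : Measure β} {n : ℕ}
    {A : β → Matrix (Fin n) (Fin n) ℂ}
    (hA : ∀ i j, AEStronglyMeasurable (fun s => A s i j) ν) :
    AEStronglyMeasurable (fun s => (A s).det) ν := by
  simp only [Matrix.det_apply']
  refine Finset.aestronglyMeasurable_fun_sum _ fun σ _ => ?_
  exact (Finset.aestronglyMeasurable_fun_prod _ fun i _ => hA _ _).const_mul _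

theorem aestronglyMeasurable_gramMinor (hb : AEStronglyMeasurable b μ) (n : ℕ) :
    AEStronglyMeasurable (fun s : Fin n → α => gramMinor b Q s) (Measure.pi fun _ => μ) :=
  aestronglyMeasurable_det fun i j => (aestronglyMeasurable_comp_eval hb i).inner
    (Q.continuous.comp_aestronglyMeasurable (aestronglyMeasurable_comp_eval hb j))

theorem aestronglyMeasurable_vectorMinor (hb : AEStronglyMeasurable b μ) (n : ℕ) (s₀ : α) :
    AEStronglyMeasurable (fun s : Fin n → α => vectorMinor b Q s₀ s) (Measure.pi fun _ => μ) := by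
  have hc : ∀ j : Fin (n + 1), AEStronglyMeasurable
      (fun s : Fin n → α => b ((Fin.cons s₀ s : Fin (n + 1) → α) j)) (Measure.pi fun _ => μ) :=
    fun j => Fin.cases (by simpa using aestronglyMeasurable_const)
      (fun j => by simpa using aestronglyMeasurable_comp_eval hb j) j
  refine Finset.aestronglyMeasurable_fun_sum _ fun j _ => AEStronglyMeasurable.smul ?_ (hc j)
  exact (aestronglyMeasurable_det fun i k => (aestronglyMeasurable_comp_eval hb i).inner
    (Q.continuous.comp_aestronglyMeasurable (hc _))).const_mul _

theorem integrable_prod_sq (hb2 : Integrable (fun s => ‖b s‖ ^ 2) μ) (n : ℕ) :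
    Integrable (fun s : Fin n → α => ∏ i, ‖Q‖ * ‖b (s i)‖ ^ 2) (Measure.pi fun _ => μ) :=
  Integrable.fintype_prod (f := fun (_ : Fin n) s => ‖Q‖ * ‖b s‖ ^ 2) fun _ => hb2.const_mul _

theorem integral_prod_sq (n : ℕ) :
    ∫ s : Fin n → α, ∏ i, ‖Q‖ * ‖b (s i)‖ ^ 2 ∂(Measure.pi fun _ => μ) =
      (‖Q‖ * ∫ s, ‖b s‖ ^ 2 ∂μ) ^ n := by
  rw [integral_fintype_prod_eq_pow (ι := Fin n) (f := fun s => ‖Q‖ * ‖b s‖ ^ 2),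
    integral_const_mul, Fintype.card_fin]

theorem integrable_gramMinor (hb : AEStronglyMeasurable b μ)
    (hb2 : Integrable (fun s => ‖b s‖ ^ 2) μ) (n : ℕ) :
    Integrable (fun s : Fin n → α => gramMinor b Q s) (Measure.pi fun _ => μ) :=
  (integrable_prod_sq hb2 n).mono' (aestronglyMeasurable_gramMinor hb n)
    (Filter.Eventually.of_forall fun s => norm_gramMinor_le b Q s)

theorem integral_norm_gramMinor_le (hb : AEStronglyMeasurable b μ)
    (hb2 : Integrable (fun s => ‖b s‖ ^ 2) μ) (n : ℕ) :
    ∫ s : Fin n → α, ‖gramMinor b Q s‖ ∂(Measure.pi fun _ => μ) ≤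
      (‖Q‖ * ∫ s, ‖b s‖ ^ 2 ∂μ) ^ n := by
  rw [← integral_prod_sq]
  exact integral_mono (integrable_gramMinor hb hb2 n).norm (integrable_prod_sq hb2 n)
    fun s => norm_gramMinor_le b Q s

theorem norm_gramCoeff_le (hb : AEStronglyMeasurable b μ)
    (hb2 : Integrable (fun s => ‖b s‖ ^ 2) μ) (n : ℕ) :
    ‖gramCoeff μ b Q n‖ ≤ (‖Q‖ * ∫ s, ‖b s‖ ^ 2 ∂μ) ^ n :=
  (norm_integral_le_integral_norm _).trans (integral_norm_gramMinor_le hb hb2 n)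

theorem gramCoeff_zero (μ : Measure α) (b : α → H) (Q : H →L[ℂ] H) : gramCoeff μ b Q 0 = 1 := by
  simp [gramCoeff, gramMinor, measureReal_def]

variable [CompleteSpace H]

theorem integrable_vectorMinor (hb : AEStronglyMeasurable b μ)
    (hb2 : Integrable (fun s => ‖b s‖ ^ 2) μ) (n : ℕ) (s₀ : α) :
    Integrable (fun s : Fin n → α => vectorMinor b Q s₀ s) (Measure.pi fun _ => μ) :=
  ((integrable_prod_sq hb2 n).const_mul ‖b s₀‖).mono' (aestronglyMeasurable_vectorMinor hb n s₀)
    (Filter.Eventually.of_forall fun s => norm_vectorMinor_le b Q s₀ s)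

theorem norm_vectorCoeff_le (hb : AEStronglyMeasurable b μ)
    (hb2 : Integrable (fun s => ‖b s‖ ^ 2) μ) (n : ℕ) (s₀ : α) :
    ‖vectorCoeff μ b Q n s₀‖ ≤ ‖b s₀‖ * (‖Q‖ * ∫ s, ‖b s‖ ^ 2 ∂μ) ^ n := by
  rw [← integral_prod_sq, ← integral_const_mul]
  exact (norm_integral_le_integral_norm _).trans
    (integral_mono (integrable_vectorMinor hb hb2 n s₀).norm
      ((integrable_prod_sq hb2 n).const_mul _) fun s => norm_vectorMinor_le b Q s₀ s)

omit [SigmaFinite μ] in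
/-- `L = ∫ b b†`, evaluated at a vector. -/
theorem integral_inner_smul_eq (hb : AEStronglyMeasurable b μ)
    (hb2 : Integrable (fun s => ‖b s‖ ^ 2) μ)
    (hL : ∀ h k, ⟪k, L h⟫_ℂ = ∫ s, ⟪k, b s⟫_ℂ * ⟪b s, h⟫_ℂ ∂μ) (h : H) :
    Integrable (fun s => ⟪b s, h⟫_ℂ • b s) μ ∧ ∫ s, ⟪b s, h⟫_ℂ • b s ∂μ = L h := by
  have hint : Integrable (fun s => ⟪b s, h⟫_ℂ • b s) μ := by
    refine (hb2.const_mul ‖h‖).mono' ((hb.inner aestronglyMeasurable_const).smul hb)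
      (Filter.Eventually.of_forall fun s => ?_)
    rw [norm_smul]
    nlinarith [norm_inner_le_norm (𝕜 := ℂ) (b s) h, norm_nonneg (b s)]
  refine ⟨hint, ext_inner_left ℂ fun k => ?_⟩
  rw [← integral_inner hint, hL]
  simp only [inner_smul_right, mul_comm]

/-- Integration of the expansion of the vector-valued minor. -/
theorem vectorCoeff_succ (hb : AEStronglyMeasurable b μ)
    (hb2 : Integrable (fun s => ‖b s‖ ^ 2) μ)
    (hL : ∀ h k, ⟪k, L h⟫_ℂ = ∫ s, ⟪k, b s⟫_ℂ * ⟪b s, h⟫_ℂ ∂μ) (n : ℕ) (s₀ : α) :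
    vectorCoeff μ b Q (n + 1) s₀ = gramCoeff μ b Q (n + 1) • b s₀ -
      ((n : ℂ) + 1) • L (Q (vectorCoeff μ b Q n s₀)) := by
  let g : α × (Fin n → α) → H := fun z => ⟪b z.1, Q (vectorMinor b Q s₀ z.2)⟫_ℂ • b z.1
  have hb1 : AEStronglyMeasurable (fun z : α × (Fin n → α) => b z.1)
      (μ.prod (Measure.pi fun _ => μ)) :=
    hb.comp_quasiMeasurePreserving Measure.quasiMeasurePreserving_fst
  have hgm : AEStronglyMeasurable g (μ.prod (Measure.pi fun _ => μ)) :=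
    (hb1.inner (Q.continuous.comp_aestronglyMeasurable
      ((aestronglyMeasurable_vectorMinor (Q := Q) hb n s₀).comp_quasiMeasurePreserving
        Measure.quasiMeasurePreserving_snd))).smul hb1
  have hgi : Integrable g (μ.prod (Measure.pi fun _ => μ)) := by
    refine ((hb2.const_mul (‖Q‖ * ‖b s₀‖)).mul_prod (integrable_prod_sq (Q := Q) hb2 n)).mono' hgm
      (Filter.Eventually.of_forall fun z => ?_)
    rw [norm_smul]
    calc ‖⟪b z.1, Q (vectorMinor b Q s₀ z.2)⟫_ℂ‖ * ‖b z.1‖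
        ≤ (‖b z.1‖ * (‖Q‖ * (‖b s₀‖ * ∏ i, ‖Q‖ * ‖b (z.2 i)‖ ^ 2))) * ‖b z.1‖ := by
          gcongr
          refine (norm_inner_le_norm _ _).trans ?_
          gcongr
          refine (Q.le_opNorm _).trans ?_
          gcongr
          exact norm_vectorMinor_le b Q s₀ z.2
      _ = _ := by ring
  have hmp : ∀ j : Fin (n + 1), MeasurePreserving
      (MeasurableEquiv.piFinSuccAbove (fun _ : Fin (n + 1) => α) j)
      (Measure.pi fun _ => μ) (μ.prod (Measure.pi fun _ => μ)) := fun j =>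
    measurePreserving_piFinSuccAbove (fun _ => μ) j
  have hcomp : ∀ j : Fin (n + 1), (fun s : Fin (n + 1) → α =>
      ⟪b (s j), Q (vectorMinor b Q s₀ fun i => s (j.succAbove i))⟫_ℂ • b (s j)) =
      g ∘ MeasurableEquiv.piFinSuccAbove (fun _ : Fin (n + 1) => α) j := fun j => rfl
  have hji : ∀ j : Fin (n + 1), Integrable (fun s : Fin (n + 1) → α =>
      ⟪b (s j), Q (vectorMinor b Q s₀ fun i => s (j.succAbove i))⟫_ℂ • b (s j))
      (Measure.pi fun _ => μ) := fun j => by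
    rw [hcomp, (hmp j).integrable_comp_emb (MeasurableEquiv.measurableEmbedding _)]
    exact hgi
  have hgint : ∫ z, g z ∂(μ.prod (Measure.pi fun _ => μ)) =
      L (Q (vectorCoeff μ b Q n s₀)) := by
    rw [integral_prod _ hgi, ← (integral_inner_smul_eq hb hb2 hL _).2]
    refine integral_congr_ae (Filter.Eventually.of_forall fun u => ?_)
    simp only [g]
    rw [integral_smul_const]
    congr 1
    have hi := integrable_vectorMinor (Q := Q) hb hb2 n s₀
    rw [integral_inner (Q.integrable_comp hi), Q.integral_comp_comm hi]
    rfl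
  have hjint : ∀ j : Fin (n + 1), ∫ s : Fin (n + 1) → α,
      ⟪b (s j), Q (vectorMinor b Q s₀ fun i => s (j.succAbove i))⟫_ℂ • b (s j)
      ∂(Measure.pi fun _ => μ) = L (Q (vectorCoeff μ b Q n s₀)) := fun j => by
    rw [← hgint, ← (hmp j).integral_comp (MeasurableEquiv.measurableEmbedding _)]
    rfl
  rw [vectorCoeff]
  simp only [vectorMinor_succ]
  rw [integral_sub ((integrable_gramMinor hb hb2 _).smul_const _)
    (integrable_finsetSum _ fun j _ => hji j), integral_smul_const,
    integral_finsetSum _ fun j _ => hji j]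
  simp only [hjint, Finset.sum_const, Finset.card_univ, Fintype.card_fin]
  rw [← Nat.cast_smul_eq_nsmul ℂ]
  push_cast
  rfl

theorem gramCoeff_succ (hb : AEStronglyMeasurable b μ)
    (hb2 : Integrable (fun s => ‖b s‖ ^ 2) μ) (n : ℕ) :
    Integrable (fun s => ⟪b s, Q (vectorCoeff μ b Q n s)⟫_ℂ) μ ∧
      gramCoeff μ b Q (n + 1) = ∫ s, ⟪b s, Q (vectorCoeff μ b Q n s)⟫_ℂ ∂μ := by
  have hmp : MeasurePreserving (MeasurableEquiv.piFinSuccAbove (fun _ : Fin (n + 1) => α) 0)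
      (Measure.pi fun _ => μ) (μ.prod (Measure.pi fun _ => μ)) :=
    measurePreserving_piFinSuccAbove (fun _ => μ) 0
  let g : α × (Fin n → α) → ℂ := fun z => ⟪b z.1, Q (vectorMinor b Q z.1 z.2)⟫_ℂ
  have hcomp : (fun s : Fin (n + 1) → α => gramMinor b Q s) =
      g ∘ MeasurableEquiv.piFinSuccAbove (fun _ : Fin (n + 1) => α) 0 := funext fun s => by
    change _ = ⟪b (s 0), Q (vectorMinor b Q (s 0) fun i => s (Fin.succAbove 0 i))⟫_ℂ
    rw [← gramMinor_cons]
    congr 1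
    ext i
    refine Fin.cases ?_ (fun i => ?_) i <;> simp
  have hint : Integrable g (μ.prod (Measure.pi fun _ => μ)) := by
    rw [← hmp.integrable_comp_emb (MeasurableEquiv.measurableEmbedding _), ← hcomp]
    exact integrable_gramMinor (Q := Q) hb hb2 (n + 1)
  have hfib : ∀ u, ∫ s : Fin n → α, g (u, s) ∂(Measure.pi fun _ => μ) =
      ⟪b u, Q (vectorCoeff μ b Q n u)⟫_ℂ := fun u => by
    have hi := integrable_vectorMinor (Q := Q) hb hb2 n u
    simp only [g]
    rw [integral_inner (Q.integrable_comp hi), Q.integral_comp_comm hi]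
    rfl
  simp only [← hfib]
  refine ⟨hint.integral_prod_left, ?_⟩
  rw [gramCoeff, hcomp]
  exact (hmp.integral_comp (MeasurableEquiv.measurableEmbedding _) g).trans (integral_prod _ hint)

end Integrals

/-! ### The Fredholm determinant as an exponential -/

section Determinant

variable {α : Type*} [MeasurableSpace α] {μ : Measure α}
  {H : Type*} [NormedAddCommGroup H] [InnerProductSpace ℂ H]
  {b : α → H} {Q L : H →L[ℂ] H}

/-- The trace of `L X`, for `L = ∫ b b†`. -/
def gramTrace (μ : Measure α) (b : α → H) (X : H →L[ℂ] H) : ℂ := ∫ s, ⟪b s, X (b s)⟫_ℂ ∂μ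

/-- The coefficient `(-t)ⁿ / n!` of the Fredholm series. -/
def fredholmWeight (n : ℕ) (t : ℝ) : ℂ := (((-t) ^ n / n.factorial : ℝ) : ℂ)

/-- The Fredholm determinant `det (I - t L Q)`, for `L = ∫ b b†`. -/
def gramDet (μ : Measure α) (b : α → H) (Q : H →L[ℂ] H) (t : ℝ) : ℂ :=
  ∑' n, fredholmWeight n t * gramCoeff μ b Q n

theorem integrable_inner_apply (hb : AEStronglyMeasurable b μ)
    (hb2 : Integrable (fun s => ‖b s‖ ^ 2) μ) (X : H →L[ℂ] H) :
    Integrable (fun s => ⟪b s, X (b s)⟫_ℂ) μ := by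
  refine (hb2.const_mul ‖X‖).mono' (hb.inner (X.continuous.comp_aestronglyMeasurable hb))
    (Filter.Eventually.of_forall fun s => (norm_inner_le_norm _ _).trans ?_)
  nlinarith [X.le_opNorm (b s), norm_nonneg (b s)]

theorem norm_gramTrace_sub_le (hb : AEStronglyMeasurable b μ)
    (hb2 : Integrable (fun s => ‖b s‖ ^ 2) μ) (X Y : H →L[ℂ] H) :
    ‖gramTrace μ b X - gramTrace μ b Y‖ ≤ (∫ s, ‖b s‖ ^ 2 ∂μ) * ‖X - Y‖ := by
  rw [gramTrace, gramTrace, ← integral_sub (integrable_inner_apply hb hb2 X)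
    (integrable_inner_apply hb hb2 Y), mul_comm, ← integral_const_mul]
  refine (norm_integral_le_integral_norm _).trans (integral_mono
    ((integrable_inner_apply hb hb2 X).sub (integrable_inner_apply hb hb2 Y)).norm
    (hb2.const_mul _) fun s => ?_)
  simp only [← inner_sub_right, ← _root_.sub_apply]
  refine (norm_inner_le_norm _ _).trans ?_
  nlinarith [(X - Y).le_opNorm (b s), norm_nonneg (b s)]

theorem continuous_gramTrace (hb : AEStronglyMeasurable b μ)
    (hb2 : Integrable (fun s => ‖b s‖ ^ 2) μ) : Continuous (gramTrace μ b) := by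
  refine (LipschitzWith.of_dist_le_mul (K := (∫ s, ‖b s‖ ^ 2 ∂μ).toNNReal)
    fun X Y => ?_).continuous
  rw [dist_eq_norm, dist_eq_norm,
    Real.coe_toNNReal _ (integral_nonneg fun s => by positivity)]
  exact norm_gramTrace_sub_le hb hb2 X Y

theorem norm_fredholmWeight (n : ℕ) (t : ℝ) :
    ‖fredholmWeight n t‖ = |t| ^ n / n.factorial := by
  rw [fredholmWeight, Complex.norm_real, Real.norm_eq_abs, abs_div, abs_pow, abs_neg,
    Nat.abs_cast]

theorem fredholmWeight_succ (n : ℕ) (t : ℝ) :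
    fredholmWeight (n + 1) t * ((n : ℂ) + 1) = -t * fredholmWeight n t := by
  have h1 : ((n : ℂ) + 1) ≠ 0 := Nat.cast_add_one_ne_zero n
  have h2 : (n.factorial : ℂ) ≠ 0 := by exact_mod_cast n.factorial_ne_zero
  simp only [fredholmWeight, Nat.factorial_succ]
  push_cast
  field_simp
  ring

theorem hasDerivAt_fredholmWeight (n : ℕ) (t : ℝ) :
    HasDerivAt (fredholmWeight (n + 1)) (-fredholmWeight n t) t := by
  have h : HasDerivAt (fun t : ℝ => (-t) ^ (n + 1) / (n + 1).factorial)
      (-((-t) ^ n / n.factorial)) t := by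
    have h1 : ((n : ℝ) + 1) ≠ 0 := Nat.cast_add_one_ne_zero n
    have h2 : (n.factorial : ℝ) ≠ 0 := by exact_mod_cast n.factorial_ne_zero
    refine (((hasDerivAt_id t).neg.pow (n + 1)).div_const _).congr_deriv ?_
    simp only [Nat.factorial_succ, Nat.add_sub_cancel]
    push_cast
    simp only [Pi.neg_apply, id]
    field_simp
  refine h.ofReal_comp.congr_deriv ?_
  rw [Complex.ofReal_neg]; rfl

variable [SigmaFinite μ]

theorem summable_fredholmWeight_mul (hb : AEStronglyMeasurable b μ)
    (hb2 : Integrable (fun s => ‖b s‖ ^ 2) μ) (t : ℝ) :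
    Summable fun n => fredholmWeight n t * gramCoeff μ b Q n := by
  refine Summable.of_norm_bounded (Real.summable_pow_div_factorial
    (|t| * (‖Q‖ * ∫ s, ‖b s‖ ^ 2 ∂μ))) fun n => ?_
  rw [norm_mul, norm_fredholmWeight, mul_pow, mul_div_right_comm]
  gcongr
  exact norm_gramCoeff_le hb hb2 n

omit [SigmaFinite μ] in
theorem gramDet_zero : gramDet μ b Q 0 = 1 := by
  rw [gramDet, tsum_eq_single 0 fun n hn => ?_]
  · simp [fredholmWeight, gramCoeff_zero]
  · simp [fredholmWeight, hn]

theorem hasDerivAt_gramDet (hb : AEStronglyMeasurable b μ)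
    (hb2 : Integrable (fun s => ‖b s‖ ^ 2) μ) (t : ℝ) :
    HasDerivAt (gramDet μ b Q) (∑' n, -fredholmWeight n t * gramCoeff μ b Q (n + 1)) t := by
  have hF : gramDet μ b Q = fun t => fredholmWeight 0 t * gramCoeff μ b Q 0 +
      ∑' n, fredholmWeight (n + 1) t * gramCoeff μ b Q (n + 1) := funext fun t =>
    (summable_fredholmWeight_mul hb hb2 t).tsum_eq_zero_add
  set c := ‖Q‖ * ∫ s, ‖b s‖ ^ 2 ∂μ with hc
  have hc0 : 0 ≤ c := mul_nonneg (norm_nonneg _) (integral_nonneg fun _ => by positivity)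
  have h0 : ∀ t, fredholmWeight 0 t * gramCoeff μ b Q 0 = 1 := fun t => by
    simp [fredholmWeight, gramCoeff_zero]
  have hd := hasDerivAt_tsum_of_isPreconnected (𝕜 := ℝ) (t := Metric.ball 0 (|t| + 1))
    (g := fun n t => fredholmWeight (n + 1) t * gramCoeff μ b Q (n + 1))
    (g' := fun n t => -fredholmWeight n t * gramCoeff μ b Q (n + 1))
    (u := fun n => (((|t| + 1) * c) ^ n / n.factorial) * c) (y₀ := t) (y := t)
    ((Real.summable_pow_div_factorial _).mul_right _) Metric.isOpen_ball
    (convex_ball _ _).isPreconnected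
    (fun n y _ => (hasDerivAt_fredholmWeight n y).mul_const _) (fun n y hy => by
      rw [norm_mul, norm_neg, norm_fredholmWeight, mul_pow, mul_div_right_comm, mul_assoc,
        ← pow_succ]
      have hy' : |y| ≤ |t| + 1 := by simpa using (mem_ball_zero_iff.1 hy).le
      gcongr
      exact norm_gramCoeff_le hb hb2 (n + 1)) (by simp)
    ((summable_nat_add_iff 1).2 (summable_fredholmWeight_mul hb hb2 t)) (by simp)
  rw [hF]
  simp only [h0]
  exact hd.const_add 1

variable [CompleteSpace H]

/-- The generating function of the integrated vector-valued minors. -/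
def vectorSeries (μ : Measure α) (b : α → H) (Q : H →L[ℂ] H) (t : ℝ) (s : α) : H :=
  ∑' n, fredholmWeight n t • vectorCoeff μ b Q n s

theorem norm_fredholmWeight_smul_le (hb : AEStronglyMeasurable b μ)
    (hb2 : Integrable (fun s => ‖b s‖ ^ 2) μ) (t : ℝ) (s : α) (n : ℕ) :
    ‖fredholmWeight n t • vectorCoeff μ b Q n s‖ ≤
      (|t| * (‖Q‖ * ∫ s, ‖b s‖ ^ 2 ∂μ)) ^ n / n.factorial * ‖b s‖ := by
  rw [norm_smul, norm_fredholmWeight, mul_pow, mul_div_right_comm, mul_assoc]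
  gcongr
  rw [mul_comm]
  exact norm_vectorCoeff_le hb hb2 n s

theorem summable_fredholmWeight_smul (hb : AEStronglyMeasurable b μ)
    (hb2 : Integrable (fun s => ‖b s‖ ^ 2) μ) (t : ℝ) (s : α) :
    Summable fun n => fredholmWeight n t • vectorCoeff μ b Q n s :=
  Summable.of_norm_bounded ((Real.summable_pow_div_factorial _).mul_right _)
    fun n => norm_fredholmWeight_smul_le hb hb2 t s n

theorem vectorCoeff_zero (μ : Measure α) (b : α → H) (Q : H →L[ℂ] H) (s : α) :
    vectorCoeff μ b Q 0 s = b s := by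
  simp [vectorCoeff, vectorMinor, measureReal_def]

/-- The resolvent equation for the generating function of the vector-valued minors. -/
theorem vectorSeries_eq (hb : AEStronglyMeasurable b μ)
    (hb2 : Integrable (fun s => ‖b s‖ ^ 2) μ)
    (hL : ∀ h k, ⟪k, L h⟫_ℂ = ∫ s, ⟪k, b s⟫_ℂ * ⟪b s, h⟫_ℂ ∂μ) (t : ℝ) (s : α) :
    vectorSeries μ b Q t s =
      gramDet μ b Q t • b s + (t : ℂ) • L (Q (vectorSeries μ b Q t s)) := by
  have hv := summable_fredholmWeight_smul (Q := Q) hb hb2 t s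
  have hg := summable_fredholmWeight_mul (Q := Q) hb hb2 t
  have hg1 := (summable_nat_add_iff 1).2 hg
  have hLQ : L (Q (vectorSeries μ b Q t s)) =
      ∑' n, fredholmWeight n t • L (Q (vectorCoeff μ b Q n s)) := by
    rw [vectorSeries, ← ContinuousLinearMap.comp_apply, (L.comp Q).map_tsum hv]
    simp
  have hs2 : Summable fun n => fredholmWeight n t • L (Q (vectorCoeff μ b Q n s)) := by
    simpa using hv.mapL (L.comp Q)
  rw [hLQ, vectorSeries, hv.tsum_eq_zero_add, gramDet, hg.tsum_eq_zero_add, add_smul,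
    gramCoeff_zero, vectorCoeff_zero, mul_one, add_assoc, ← hg1.tsum_smul_const,
    ← hs2.tsum_const_smul, ← (hg1.smul_const (b s)).tsum_add (hs2.const_smul _)]
  congr 1
  refine tsum_congr fun n => ?_
  rw [vectorCoeff_succ hb hb2 hL, smul_sub, smul_smul, smul_smul, fredholmWeight_succ, smul_smul,
    neg_mul, neg_smul, sub_neg_eq_add]

theorem tsum_fredholmWeight_mul_succ (hb : AEStronglyMeasurable b μ)
    (hb2 : Integrable (fun s => ‖b s‖ ^ 2) μ) (t : ℝ) :
    ∑' n, -fredholmWeight n t * gramCoeff μ b Q (n + 1) =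
      -∫ s, ⟪b s, Q (vectorSeries μ b Q t s)⟫_ℂ ∂μ := by
  set c := ‖Q‖ * ∫ s, ‖b s‖ ^ 2 ∂μ with hc
  have hint : ∀ n,
      Integrable (fun s => ⟪b s, Q (fredholmWeight n t • vectorCoeff μ b Q n s)⟫_ℂ) μ :=
    fun n => by
      simp only [map_smul, inner_smul_right]
      exact (gramCoeff_succ hb hb2 n).1.const_mul _
  have hs := hasSum_integral_of_summable_integral_norm hint (by
    refine Summable.of_norm_bounded ((Real.summable_pow_div_factorial (|t| * c)).mul_right c)
      fun n => ?_
    rw [Real.norm_of_nonneg (integral_nonneg fun _ => norm_nonneg _), hc, ← mul_assoc,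
      ← integral_const_mul]
    refine integral_mono (hint n).norm (hb2.const_mul _) fun s => ?_
    refine (norm_inner_le_norm _ _).trans ?_
    calc ‖b s‖ * ‖Q (fredholmWeight n t • vectorCoeff μ b Q n s)‖
        ≤ ‖b s‖ * (‖Q‖ * ((|t| * c) ^ n / n.factorial * ‖b s‖)) := by
          gcongr
          refine (Q.le_opNorm _).trans ?_
          gcongr
          exact norm_fredholmWeight_smul_le hb hb2 t s n
      _ = _ := by rw [hc]; ring)
  simp only [neg_mul]
  rw [tsum_neg]
  congr 1
  have h2 : ∀ s, ∑' n, ⟪b s, Q (fredholmWeight n t • vectorCoeff μ b Q n s)⟫_ℂ =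
      ⟪b s, Q (vectorSeries μ b Q t s)⟫_ℂ := fun s => by
    have := ((innerSL ℂ (b s)).comp Q).map_tsum (summable_fredholmWeight_smul (Q := Q) hb hb2 t s)
    simpa [vectorSeries] using this.symm
  simp only [h2] at hs
  rw [← hs.tsum_eq]
  refine tsum_congr fun n => ?_
  rw [(gramCoeff_succ hb hb2 n).2, ← integral_const_mul]
  simp only [map_smul, inner_smul_right]

/-- `d/dt det (I - t L Q) = - det (I - t L Q) tr (L Q (I - t L Q)⁻¹)`, because the vector-valued
series solves `(I - t L Q) w = det (I - t L Q) b`. -/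
theorem hasDerivAt_gramDet_of_isUnit (hb : AEStronglyMeasurable b μ)
    (hb2 : Integrable (fun s => ‖b s‖ ^ 2) μ)
    (hL : ∀ h k, ⟪k, L h⟫_ℂ = ∫ s, ⟪k, b s⟫_ℂ * ⟪b s, h⟫_ℂ ∂μ) (t : ℝ)
    (hu : IsUnit (1 - (t : ℂ) • (L * Q))) :
    HasDerivAt (gramDet μ b Q) (-(gramDet μ b Q t *
      gramTrace μ b (Q * Ring.inverse (1 - (t : ℂ) • (L * Q))))) t := by
  have hW : ∀ s, vectorSeries μ b Q t s =
      gramDet μ b Q t • Ring.inverse (1 - (t : ℂ) • (L * Q)) (b s) := fun s => by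
    have h1 : (1 - (t : ℂ) • (L * Q)) (vectorSeries μ b Q t s) = gramDet μ b Q t • b s := by
      have := vectorSeries_eq (Q := Q) hb hb2 hL t s
      simp only [_root_.sub_apply, one_apply_eq_self,
        _root_.smul_apply, mul_apply_eq_comp]
      exact sub_eq_of_eq_add this
    rw [← map_smul, ← h1, ← mul_apply_eq_comp, Ring.inverse_mul_cancel _ hu,
      one_apply_eq_self]
  refine (hasDerivAt_gramDet hb hb2 t).congr_deriv ?_
  rw [tsum_fredholmWeight_mul_succ hb hb2, gramTrace, ← integral_const_mul]
  congr 2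
  funext s
  rw [hW, map_smul, inner_smul_right, mul_apply_eq_comp]

omit [CompleteSpace H] in
theorem norm_smul_mul_lt_one {t : ℝ} (ht : t ∈ Icc (0 : ℝ) 1) {Z : H →L[ℂ] H} (hZ : ‖Z‖ < 1) :
    ‖(t : ℂ) • Z‖ < 1 := by
  rw [norm_smul, Complex.norm_real, Real.norm_of_nonneg ht.1]
  nlinarith [ht.2, norm_nonneg Z]

theorem continuousOn_inverse_one_sub_smul {Z : H →L[ℂ] H} (hZ : ‖Z‖ < 1) :
    ContinuousOn (fun t : ℝ => Ring.inverse (1 - (t : ℂ) • Z)) (Icc 0 1) := fun t ht => by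
  have h1 := NormedRing.inverse_continuousAt (Units.oneSub _ (norm_smul_mul_lt_one ht hZ))
  rw [Units.val_oneSub] at h1
  exact (ContinuousAt.comp (f := fun t : ℝ => 1 - (t : ℂ) • Z) h1
    (by fun_prop)).continuousWithinAt

omit [SigmaFinite μ] in
theorem continuousOn_gramTrace_resolvent (hb : AEStronglyMeasurable b μ)
    (hb2 : Integrable (fun s => ‖b s‖ ^ 2) μ) (hLQ : ‖L * Q‖ < 1) :
    ContinuousOn (fun t : ℝ => gramTrace μ b (Q * Ring.inverse (1 - (t : ℂ) • (L * Q))))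
      (Icc 0 1) :=
  (continuous_gramTrace hb hb2).comp_continuousOn
    (continuousOn_const.mul (continuousOn_inverse_one_sub_smul hLQ))

/-- `det (I - L Q) = exp (- ∫₀¹ tr (L Q (I - t L Q)⁻¹) dt)`. -/
theorem gramDet_one_eq_exp (hb : AEStronglyMeasurable b μ)
    (hb2 : Integrable (fun s => ‖b s‖ ^ 2) μ)
    (hL : ∀ h k, ⟪k, L h⟫_ℂ = ∫ s, ⟪k, b s⟫_ℂ * ⟪b s, h⟫_ℂ ∂μ) (hLQ : ‖L * Q‖ < 1) :
    gramDet μ b Q 1 = Complex.exp (-∫ t in (0 : ℝ)..1,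
      gramTrace μ b (Q * Ring.inverse (1 - (t : ℂ) • (L * Q)))) := by
  set G : ℝ → ℂ := fun t => gramTrace μ b (Q * Ring.inverse (1 - (t : ℂ) • (L * Q))) with hG
  have hGc : ContinuousOn G (Icc 0 1) := continuousOn_gramTrace_resolvent hb hb2 hLQ
  have hI : ∀ t ∈ Ico (0 : ℝ) 1, HasDerivWithinAt (fun u => ∫ v in (0 : ℝ)..u, G v) (G t)
      (Ici t) t := fun t ht => by
    have hGt : ContinuousWithinAt G (Ioi t) t :=
      (hGc t ⟨ht.1, ht.2.le⟩).mono_of_mem_nhdsWithin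
        (Filter.mem_of_superset (Ioo_mem_nhdsGT ht.2) fun y hy => ⟨ht.1.trans hy.1.le, hy.2.le⟩)
    refine intervalIntegral.integral_hasDerivWithinAt_right ?_ ?_ hGt
    · exact (hGc.mono (by rw [uIcc_of_le ht.1]; exact Icc_subset_Icc_right ht.2.le)).intervalIntegrable
    · refine ⟨Ioo t 1, Ioo_mem_nhdsGT ht.2, ?_⟩
      exact (hGc.mono fun y hy => ⟨ht.1.trans hy.1.le, hy.2.le⟩).aestronglyMeasurable
        measurableSet_Ioo
  have hIc : ContinuousOn (fun u => ∫ v in (0 : ℝ)..u, G v) (Icc 0 1) := by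
    have := intervalIntegral.continuousOn_primitive_interval (μ := volume) (f := G) (a := 0) (b := 1)
      (by rw [uIcc_of_le zero_le_one]; exact hGc.integrableOn_Icc)
    rwa [uIcc_of_le zero_le_one] at this
  have hD : ∀ t ∈ Icc (0 : ℝ) 1, HasDerivAt (gramDet μ b Q) (-(gramDet μ b Q t * G t)) t :=
    fun t ht => hasDerivAt_gramDet_of_isUnit hb hb2 hL t
      (isUnit_one_sub_of_norm_lt_one (norm_smul_mul_lt_one ht hLQ))
  -- The product of the determinant and `exp (∫₀ᵗ G)` is constant, and it is `1` at `t = 0`.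
  have key := constant_of_has_deriv_right_zero
    (f := fun t => gramDet μ b Q t * Complex.exp (∫ v in (0 : ℝ)..t, G v)) (a := 0) (b := 1)
    (ContinuousOn.mul (fun t ht => (hD t ht).continuousAt.continuousWithinAt) hIc.cexp)
    (fun t ht => by
      refine ((hD t ⟨ht.1, ht.2.le⟩).hasDerivWithinAt.mul (hI t ht).cexp).congr_deriv ?_
      ring) 1 ⟨zero_le_one, le_rfl⟩
  simp only [intervalIntegral.integral_same, Complex.exp_zero, mul_one, gramDet_zero] at key
  rw [Complex.exp_neg]
  exact eq_inv_of_mul_eq_one_left key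

end Determinant

/-! ### Weakly differentiable operator families -/

section WeakDerivative

open Filter Asymptotics Topology

/-- Differentiation under the integral sign, when the difference quotients at `x₀` are dominated. -/
theorem hasDerivAt_integral_of_norm_sub_le {α E : Type*} [MeasurableSpace α] {μ : Measure α}
    [NormedAddCommGroup E] [NormedSpace ℝ E] [CompleteSpace E] {F : ℝ → α → E} {F' : α → E}
    {bound : α → ℝ} {x₀ : ℝ} {s : Set ℝ} (hs : s ∈ 𝓝 x₀)
    (hF_meas : ∀ x ∈ s, AEStronglyMeasurable (F x) μ) (hF_int : Integrable (F x₀) μ)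
    (hF'_meas : AEStronglyMeasurable F' μ)
    (h_lip : ∀ᵐ a ∂μ, ∀ x ∈ s, ‖F x a - F x₀ a‖ ≤ bound a * |x - x₀|)
    (hbound : Integrable bound μ) (h_diff : ∀ᵐ a ∂μ, HasDerivAt (F · a) (F' a) x₀) :
    HasDerivAt (fun x => ∫ a, F x a ∂μ) (∫ a, F' a ∂μ) x₀ := by
  set T : E →L[ℝ] ℝ →L[ℝ] E := ContinuousLinearMap.smulRightL ℝ ℝ E 1
  have hm : AEStronglyMeasurable (T ∘ F') μ := T.continuous.comp_aestronglyMeasurable hF'_meas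
  obtain ⟨hi, key⟩ := hasFDerivAt_integral_of_dominated_loc_of_lip' (𝕜 := ℝ) hs hF_meas hF_int hm
    h_lip hbound (h_diff.mono fun x hx => hx.hasFDerivAt)
  have hi' : Integrable F' μ := by
    rw [← integrable_norm_iff hm] at hi
    simpa [T, (· ∘ ·), integrable_norm_iff hF'_meas] using! hi
  rw [hasDerivAt_iff_hasFDerivAt]
  simpa only [(· ∘ ·), ContinuousLinearMap.integral_comp_comm _ hi'] using! key

variable {H : Type*} [NormedAddCommGroup H] [InnerProductSpace ℂ H]

/-- The operator family `T` has the derivative `T'` at `x₀` in the weak operator topology, and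
its difference quotients at `x₀` are bounded in norm. This is what a weak operator integral
satisfies, and the bound makes products and inverses differentiable. -/
structure HasWeakDerivAt (T : ℝ → H →L[ℂ] H) (T' : H →L[ℂ] H) (x₀ : ℝ) : Prop where
  isBigO : (fun x => T x - T x₀) =O[𝓝 x₀] fun x => x - x₀
  weak : ∀ h k, HasDerivAt (fun x => ⟪k, T x h⟫_ℂ) ⟪k, T' h⟫_ℂ x₀

namespace HasWeakDerivAt

variable {S T : ℝ → H →L[ℂ] H} {S' T' : H →L[ℂ] H} {x₀ : ℝ}

theorem continuousAt (hT : HasWeakDerivAt T T' x₀) : ContinuousAt T x₀ := by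
  have h : Tendsto (fun x : ℝ => x - x₀) (𝓝 x₀) (𝓝 0) := by
    have : ContinuousAt (fun x : ℝ => x - x₀) x₀ := by fun_prop
    simpa [ContinuousAt] using this
  exact tendsto_sub_nhds_zero_iff.1 (hT.isBigO.trans_tendsto h)

theorem const_sub_smul (hT : HasWeakDerivAt T T' x₀) (A : H →L[ℂ] H) (c : ℂ) :
    HasWeakDerivAt (fun x => A - c • T x) (-(c • T')) x₀ where
  isBigO := by
    have := (hT.isBigO.const_smul_left c).neg_left
    refine this.congr_left fun x => ?_
    simp only [Pi.smul_apply, smul_sub]; abel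
  weak h k := by
    simp only [_root_.sub_apply, inner_sub_right, _root_.smul_apply, inner_smul_right,
      _root_.neg_apply, inner_neg_right]
    exact ((hT.weak h k).const_mul c).const_sub _

/-- A quadratically small remainder does not affect weak derivatives. -/
theorem of_sub_isBigO_sq {R : ℝ → H →L[ℂ] H} (hT : HasWeakDerivAt T T' x₀)
    (hR : (fun x => R x - R x₀ - (T x - T x₀)) =O[𝓝 x₀] fun x => (x - x₀) ^ 2) :
    HasWeakDerivAt R T' x₀ where
  isBigO := by
    have h1 : (fun x : ℝ => (x - x₀) ^ 2) =O[𝓝 x₀] fun x => x - x₀ := by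
      have h : ContinuousAt (fun x : ℝ => x - x₀) x₀ := by fun_prop
      simpa [pow_two] using (h.isBigO_one ℝ).mul (isBigO_refl (fun x : ℝ => x - x₀) (𝓝 x₀))
    refine ((hR.trans h1).add hT.isBigO).congr_left fun x => ?_
    abel
  weak h k := by
    have h0 : HasDerivAt (fun x => ⟪k, (R x - R x₀ - (T x - T x₀)) h⟫_ℂ) 0 x₀ := by
      rw [hasDerivAt_iff_isLittleO]
      simp only [sub_self, _root_.zero_apply, inner_zero_right, smul_zero, sub_zero]
      refine IsBigO.trans_isLittleO (g := fun x : ℝ => (x - x₀) ^ 2) ?_ ?_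
      · refine IsBigO.trans ?_ hR
        refine IsBigO.of_bound (‖k‖ * ‖h‖) (Eventually.of_forall fun x => ?_)
        refine (norm_inner_le_norm _ _).trans ?_
        calc ‖k‖ * ‖(R x - R x₀ - (T x - T x₀)) h‖
            ≤ ‖k‖ * (‖R x - R x₀ - (T x - T x₀)‖ * ‖h‖) := by
              gcongr; exact ContinuousLinearMap.le_opNorm _ _
          _ = _ := by ring
      · simpa only [Real.norm_eq_abs, sq_abs] using isLittleO_pow_sub_sub x₀ one_lt_two
    have := h0.add ((hT.weak h k).add_const (⟪k, R x₀ h⟫_ℂ - ⟪k, T x₀ h⟫_ℂ))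
    rw [zero_add] at this
    refine this.congr_of_eventuallyEq (Eventually.of_forall fun x => ?_)
    simp only [Pi.add_apply, _root_.sub_apply, inner_sub_right]
    ring

variable [CompleteSpace H]

/-- A weakly differentiable family between two fixed operators. -/
theorem const_mul_mul_const (hT : HasWeakDerivAt T T' x₀) (A B : H →L[ℂ] H) :
    HasWeakDerivAt (fun x => A * T x * B) (A * T' * B) x₀ where
  isBigO := by
    refine IsBigO.trans (g := fun x => T x - T x₀) ?_ hT.isBigO
    refine IsBigO.of_bound (‖A‖ * ‖B‖) (Eventually.of_forall fun x => ?_)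
    rw [← sub_mul, ← mul_sub]
    calc ‖A * (T x - T x₀) * B‖ ≤ ‖A‖ * ‖T x - T x₀‖ * ‖B‖ :=
          (norm_mul_le _ _).trans (by gcongr; exact norm_mul_le _ _)
      _ = _ := by ring
  weak h k := by
    simp only [mul_apply_eq_comp, ← ContinuousLinearMap.adjoint_inner_left A]
    exact hT.weak _ _

omit [CompleteSpace H] in
theorem add (hS : HasWeakDerivAt S S' x₀) (hT : HasWeakDerivAt T T' x₀) :
    HasWeakDerivAt (fun x => S x + T x) (S' + T') x₀ where
  isBigO := (hS.isBigO.add hT.isBigO).congr_left fun x => by abel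
  weak h k := by
    simp only [_root_.add_apply, inner_add_right]
    exact (hS.weak h k).add (hT.weak h k)

theorem mul (hS : HasWeakDerivAt S S' x₀) (hT : HasWeakDerivAt T T' x₀) :
    HasWeakDerivAt (fun x => S x * T x) (S' * T x₀ + S x₀ * T') x₀ := by
  have h := (hS.const_mul_mul_const 1 (T x₀)).add (hT.const_mul_mul_const (S x₀) 1)
  simp only [one_mul, mul_one] at h
  refine h.of_sub_isBigO_sq (((hS.isBigO.mul hT.isBigO)).congr (fun x => ?_) fun x => ?_)
  · noncomm_ring
  · ring

theorem ringInverse (hT : HasWeakDerivAt T T' x₀) (hu : IsUnit (T x₀)) :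
    HasWeakDerivAt (fun x => Ring.inverse (T x))
      (-(Ring.inverse (T x₀) * T' * Ring.inverse (T x₀))) x₀ := by
  set A := Ring.inverse (T x₀) with hA
  have hA1 : T x₀ * A = 1 := Ring.mul_inverse_cancel _ hu
  have hA2 : A * T x₀ = 1 := Ring.inverse_mul_cancel _ hu
  have hcont : ContinuousAt (fun x => Ring.inverse (T x)) x₀ := by
    obtain ⟨u, hu'⟩ := hu
    refine ContinuousAt.comp (f := T) (g := Ring.inverse) ?_ hT.continuousAt
    rw [← hu']
    exact NormedRing.inverse_continuousAt u
  have hun : ∀ᶠ x in 𝓝 x₀, IsUnit (T x) :=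
    hT.continuousAt.eventually (Units.isOpen.mem_nhds hu)
  have hdiff : ∀ᶠ x in 𝓝 x₀, Ring.inverse (T x) - A = -(Ring.inverse (T x) * (T x - T x₀) * A) :=
    hun.mono fun x hx => by
      have h2 := Ring.inverse_mul_cancel _ hx
      rw [mul_sub, sub_mul, h2, mul_assoc, hA1]
      noncomm_ring
  have hlip : (fun x => Ring.inverse (T x) - A) =O[𝓝 x₀] fun x => x - x₀ := by
    have h1 := ((hcont.isBigO_one ℝ).mul hT.isBigO).mul
      (isBigO_const_const A (one_ne_zero (α := ℝ)) (𝓝 x₀))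
    refine (h1.neg_left.congr' (hdiff.mono fun x hx => hx.symm) (Eventually.of_forall fun x => ?_))
    ring
  have h := hT.const_mul_mul_const (-A) A
  have hneg : -(A * T' * A) = -A * T' * A := by noncomm_ring
  rw [hneg]
  refine h.of_sub_isBigO_sq ?_
  have h2 := ((hlip.mul hT.isBigO).mul
    (isBigO_const_const A (one_ne_zero (α := ℝ)) (𝓝 x₀))).neg_left
  refine h2.congr' (hdiff.mono fun x hx => ?_) (Eventually.of_forall fun x => ?_)
  · simp only [← hA]
    conv_rhs => rw [hx]
    noncomm_ring
  · ring

omit [CompleteSpace H] in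
/-- The trace of `L T(x)` is differentiable, for `L = ∫ b b†` and a weakly differentiable `T`. -/
theorem hasDerivAt_gramTrace {α : Type*} [MeasurableSpace α] {μ : Measure α} {b : α → H}
    (hT : HasWeakDerivAt T T' x₀) (hb : AEStronglyMeasurable b μ)
    (hb2 : Integrable (fun s => ‖b s‖ ^ 2) μ) :
    HasDerivAt (fun x => gramTrace μ b (T x)) (gramTrace μ b T') x₀ := by
  obtain ⟨C, hC⟩ := hT.isBigO.bound
  refine hasDerivAt_integral_of_norm_sub_le (bound := fun s => C * ‖b s‖ ^ 2) hC
    (fun x _ => (integrable_inner_apply hb hb2 _).1) (integrable_inner_apply hb hb2 _)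
    (integrable_inner_apply hb hb2 _).1 (Eventually.of_forall fun s x hx => ?_)
    (hb2.const_mul C) (Eventually.of_forall fun s => hT.weak _ _)
  rw [← inner_sub_right, ← _root_.sub_apply]
  refine (norm_inner_le_norm _ _).trans ?_
  have hx' : ‖T x - T x₀‖ ≤ C * |x - x₀| := hx
  calc ‖b s‖ * ‖(T x - T x₀) (b s)‖ ≤ ‖b s‖ * ((C * |x - x₀|) * ‖b s‖) := by
        gcongr
        exact (ContinuousLinearMap.le_opNorm _ _).trans (by gcongr)
    _ = _ := by ring

end HasWeakDerivAt

/-! ### Operator integrals over half lines -/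

theorem norm_le_of_norm_inner_le {T : H →L[ℂ] H} {C : ℝ} (hC : 0 ≤ C)
    (h : ∀ x y, ‖⟪y, T x⟫_ℂ‖ ≤ C * ‖x‖ * ‖y‖) : ‖T‖ ≤ C := by
  refine T.opNorm_le_bound hC fun x => ?_
  have h1 := h x (T x)
  rw [inner_self_eq_norm_sq_to_K, norm_pow, RCLike.norm_ofReal, abs_norm, pow_two] at h1
  by_cases h0 : ‖T x‖ = 0
  · rw [h0]; positivity
  · exact le_of_mul_le_mul_right h1 (lt_of_le_of_ne (norm_nonneg _) (Ne.symm h0))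

theorem integral_Ioi_sub_integral_Ioi_eq {f : ℝ → ℂ} {a x y : ℝ} (hfi : ∀ x, a < x →
    IntegrableOn f (Ioi x)) (hx : a < x) (hy : a < y) :
    (∫ s in Ioi x, f s) - ∫ s in Ioi y, f s = -∫ s in y..x, f s := by
  rw [intervalIntegral.integral_Ioi_sub_Ioi' (hfi x hx) (hfi y hy), intervalIntegral.integral_symm]

/-- The fundamental theorem of calculus for integrals over half lines. -/
theorem hasDerivAt_integral_Ioi {f : ℝ → ℂ} {a : ℝ} (hf : ContinuousOn f (Ioi a))
    (hfi : ∀ x, a < x → IntegrableOn f (Ioi x)) {x₀ : ℝ} (hx₀ : a < x₀) :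
    HasDerivAt (fun x => ∫ s in Ioi x, f s) (-f x₀) x₀ := by
  have h1 : HasDerivAt (fun x => ∫ s in x₀..x, f s) (f x₀) x₀ :=
    intervalIntegral.integral_hasDerivAt_right (by simp)
      (hf.stronglyMeasurableAtFilter isOpen_Ioi x₀ hx₀) (hf.continuousAt (Ioi_mem_nhds hx₀))
  refine (h1.neg.const_add (∫ s in Ioi x₀, f s)).congr_of_eventuallyEq ?_
  filter_upwards [Ioi_mem_nhds hx₀] with x hx
  have := integral_Ioi_sub_integral_Ioi_eq hfi hx hx₀
  simp only [Pi.neg_apply]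
  rw [← this]; ring

/-- The operator integral `T x = ∫_x^∞ F` has the weak derivative `-F x`. -/
theorem hasWeakDerivAt_operatorIntegral {F T : ℝ → H →L[ℂ] H} {a : ℝ}
    (hT : ∀ x, a < x → IsOperatorIntegral F x (T x))
    (hF : ∀ h k, ContinuousOn (fun s => ⟪k, F s h⟫_ℂ) (Ioi a))
    (hFb : ∀ x y, a < x → ∃ C, ∀ s ∈ Icc x y, ‖F s‖ ≤ C) {x₀ : ℝ} (hx₀ : a < x₀) :
    HasWeakDerivAt T (-F x₀) x₀ where
  isBigO := by
    obtain ⟨x₁, hx₁, hx₁'⟩ := exists_between hx₀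
    obtain ⟨C, hC⟩ := hFb x₁ (x₀ + 1) hx₁
    have hC0 : 0 ≤ C := (norm_nonneg _).trans (hC x₀ ⟨hx₁'.le, by linarith⟩)
    refine IsBigO.of_bound C ?_
    filter_upwards [Icc_mem_nhds hx₁' (lt_add_one x₀)] with x hx
    refine norm_le_of_norm_inner_le (by positivity) fun h k => ?_
    have hax : a < x := hx₁.trans_le hx.1
    rw [_root_.sub_apply, inner_sub_right, (hT x hax h k).2, (hT x₀ hx₀ h k).2,
      integral_Ioi_sub_integral_Ioi_eq (fun x hx => (hT x hx h k).1) hax hx₀, norm_neg,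
      Real.norm_eq_abs]
    calc ‖∫ s in x₀..x, ⟪k, F s h⟫_ℂ‖ ≤ (C * ‖h‖ * ‖k‖) * |x - x₀| :=
          intervalIntegral.norm_integral_le_of_norm_le_const fun s hs => by
            have hs' : s ∈ Icc x₁ (x₀ + 1) :=
              uIcc_subset_Icc ⟨hx₁'.le, by linarith⟩ hx (uIoc_subset_uIcc hs)
            refine (norm_inner_le_norm _ _).trans ?_
            calc ‖k‖ * ‖F s h‖ ≤ ‖k‖ * (C * ‖h‖) := by
                  gcongr
                  exact ((F s).le_opNorm h).trans (by gcongr; exact hC s hs')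
              _ = _ := by ring
      _ = _ := by ring
  weak h k := by
    rw [_root_.neg_apply, inner_neg_right]
    refine (hasDerivAt_integral_Ioi (hF h k) (fun x hx => (hT x hx h k).1) hx₀).congr_of_eventuallyEq
      ?_
    filter_upwards [Ioi_mem_nhds hx₀] with x hx using (hT x hx h k).2

end WeakDerivative

/-! ### Square integrability from the trace class property -/

section TraceClass

variable {H : Type*} [NormedAddCommGroup H] [InnerProductSpace ℂ H]

theorem Orthonormal.countable_of_separable [TopologicalSpace.SeparableSpace H] {ι : Type*}
    {e : ι → H} (he : Orthonormal ℂ e) : Countable ι := by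
  have hd : ∀ i j, i ≠ j → 1 ≤ dist (e i) (e j) := fun i j hij => by
    have h1 : ‖e i - e j‖ ^ 2 = 2 := by
      rw [@norm_sub_sq ℂ, he.1 i, he.1 j, he.2 hij]; norm_num
    rw [dist_eq_norm]
    nlinarith [norm_nonneg (e i - e j)]
  have hp : (univ : Set ι).PairwiseDisjoint fun i => Metric.ball (e i) (1 / 2) :=
    fun i _ j _ hij => Metric.ball_disjoint_ball (by norm_num; exact hd i j hij)
  exact countable_univ_iff.1 (hp.countable_of_isOpen (fun _ _ => Metric.isOpen_ball)
    fun i _ => ⟨e i, Metric.mem_ball_self (by norm_num)⟩)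

/-- The diagonal of a trace class operator in an orthonormal family is absolutely summable. -/
theorem IsTraceClass.summable_norm_inner {T : H →L[ℂ] H} (hT : IsTraceClass T) {ι : Type*}
    {e : ι → H} (he : Orthonormal ℂ e) : Summable fun i => ‖⟪e i, T (e i)⟫_ℂ‖ := by
  obtain ⟨u, v, huv, hsum⟩ := hT
  have h1 : ∀ i n, ‖⟪e i, ⟪v n, e i⟫_ℂ • u n⟫_ℂ‖ ≤ ‖u n‖ * ‖v n‖ := fun i n => by
    have hu := norm_inner_le_norm (𝕜 := ℂ) (e i) (u n)
    have hv := norm_inner_le_norm (𝕜 := ℂ) (v n) (e i)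
    rw [he.1 i] at hu hv
    rw [inner_smul_right, norm_mul, mul_comm ‖u n‖]
    gcongr <;> linarith
  have h2 : ∀ i, Summable fun n => ‖⟪e i, ⟪v n, e i⟫_ℂ • u n⟫_ℂ‖ := fun i =>
    huv.of_nonneg_of_le (fun _ => norm_nonneg _) (h1 i)
  refine summable_of_sum_le (c := ∑' n, ‖u n‖ * ‖v n‖) (fun _ => norm_nonneg _) fun F => ?_
  calc ∑ i ∈ F, ‖⟪e i, T (e i)⟫_ℂ‖ ≤ ∑ i ∈ F, ∑' n, ‖⟪e i, ⟪v n, e i⟫_ℂ • u n⟫_ℂ‖ := by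
        refine Finset.sum_le_sum fun i _ => ?_
        have := (hsum (e i)).mapL (innerSL ℂ (e i))
        simp only [innerSL_apply_apply] at this
        rw [← this.tsum_eq]
        exact norm_tsum_le_tsum_norm (h2 i)
    _ = ∑' n, ∑ i ∈ F, ‖⟪e i, ⟪v n, e i⟫_ℂ • u n⟫_ℂ‖ :=
        (Summable.tsum_finsetSum fun i _ => h2 i).symm
    _ ≤ ∑' n, ‖u n‖ * ‖v n‖ := by
        refine Summable.tsum_le_tsum (fun n => ?_) (summable_sum fun i _ => h2 i) huv
        have hs := Finset.sum_mul_sq_le_sq_mul_sq F (fun i => ‖⟪e i, u n⟫_ℂ‖)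
          (fun i => ‖⟪e i, v n⟫_ℂ‖)
        have hu := he.sum_inner_products_le (u n) (s := F)
        have hv := he.sum_inner_products_le (v n) (s := F)
        have heq : ∑ i ∈ F, ‖⟪e i, ⟪v n, e i⟫_ℂ • u n⟫_ℂ‖ =
            ∑ i ∈ F, ‖⟪e i, u n⟫_ℂ‖ * ‖⟪e i, v n⟫_ℂ‖ := Finset.sum_congr rfl fun i _ => by
          rw [inner_smul_right, norm_mul, norm_inner_symm (v n), mul_comm]
        rw [heq]
        refine le_of_sq_le_sq ?_ (by positivity)
        rw [mul_pow]
        exact hs.trans (by gcongr)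

/-- If `L = ∫ b b†` is trace class, then `∫ ‖b‖² < ∞`: by Parseval's identity and monotone
convergence the integral is the sum of the diagonal of `L` in an orthonormal basis, which is
countable since `H` is separable. -/
theorem integrable_norm_sq_of_isTraceClass [CompleteSpace H] [TopologicalSpace.SeparableSpace H]
    {α : Type*} [MeasurableSpace α] {μ : Measure α} {b : α → H} {L : H →L[ℂ] H}
    (hb : AEStronglyMeasurable b μ) (hL : IsTraceClass L)
    (hLb : ∀ h, Integrable (fun s => ⟪h, b s⟫_ℂ * ⟪b s, h⟫_ℂ) μ ∧
      ⟪h, L h⟫_ℂ = ∫ s, ⟪h, b s⟫_ℂ * ⟪b s, h⟫_ℂ ∂μ) :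
    Integrable (fun s => ‖b s‖ ^ 2) μ := by
  obtain ⟨w, e, -⟩ := exists_hilbertBasis ℂ H
  have : Countable w := e.orthonormal.countable_of_separable
  have hsq : ∀ (h x : H), ⟪h, x⟫_ℂ * ⟪x, h⟫_ℂ = ((‖⟪h, x⟫_ℂ‖ ^ 2 : ℝ) : ℂ) := fun h x => by
    rw [← inner_conj_symm x h, Complex.mul_conj']; push_cast; rfl
  have hpars : ∀ x : H, HasSum (fun i => ‖⟪e i, x⟫_ℂ‖ ^ 2) (‖x‖ ^ 2) := fun x => by
    have h1 := e.hasSum_inner_mul_inner x x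
    have h2 : (⟪x, x⟫_ℂ) = ((‖x‖ ^ 2 : ℝ) : ℂ) := by
      rw [inner_self_eq_norm_sq_to_K]; push_cast; rfl
    simp only [hsq, h2] at h1
    simp only [norm_inner_symm x] at h1
    exact_mod_cast h1
  have hint : ∀ i, Integrable (fun s => ‖⟪e i, b s⟫_ℂ‖ ^ 2) μ := fun i => by
    have := (hLb (e i)).1
    simp only [hsq] at this
    exact this.re
  have hval : ∀ i, ∫ s, ‖⟪e i, b s⟫_ℂ‖ ^ 2 ∂μ = ‖⟪e i, L (e i)⟫_ℂ‖ := fun i => by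
    rw [(hLb (e i)).2]
    simp only [hsq]
    rw [integral_complex_ofReal, Complex.norm_real,
      Real.norm_of_nonneg (integral_nonneg fun s => by positivity)]
  refine ⟨hb.norm.pow 2, ?_⟩
  rw [hasFiniteIntegral_iff_ofReal (Filter.Eventually.of_forall fun s => by positivity)]
  have hpt : ∀ s, ENNReal.ofReal (‖b s‖ ^ 2) = ∑' i, ENNReal.ofReal (‖⟪e i, b s⟫_ℂ‖ ^ 2) :=
    fun s => by
      rw [← (hpars (b s)).tsum_eq, ENNReal.ofReal_tsum_of_nonneg (fun _ => by positivity)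
        (hpars (b s)).summable]
  simp only [hpt]
  rw [lintegral_tsum fun i => (hint i).1.aemeasurable.ennreal_ofReal]
  have hterm : ∀ i, ∫⁻ s, ENNReal.ofReal (‖⟪e i, b s⟫_ℂ‖ ^ 2) ∂μ =
      ENNReal.ofReal ‖⟪e i, L (e i)⟫_ℂ‖ := fun i => by
    rw [← hval, ofReal_integral_eq_lintegral_ofReal (hint i)
      (Filter.Eventually.of_forall fun s => by positivity)]
  simp only [hterm]
  rw [← ENNReal.ofReal_tsum_of_nonneg (fun _ => norm_nonneg _)
    (hL.summable_norm_inner e.orthonormal)]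
  exact ENNReal.ofReal_lt_top

end TraceClass

/-! ### Regularity of the linear system and its Gramians -/

/-- The diagonal entries of `σ_{3,3}`. -/
def sign33 : Fin 3 ⊕ Fin 3 → ℂ := Sum.elim (fun _ => 1) fun _ => -1

theorem sigma33_eq_diagonal : sigma33 = diagonal sign33 := by
  ext i j
  rcases i with i | i <;> rcases j with j | j <;> by_cases h : i = j <;>
    simp [sigma33, sign33, h]

theorem sigmaOp_apply (v : EuclideanSpace ℂ (Fin 3 ⊕ Fin 3)) (i : Fin 3 ⊕ Fin 3) :
    sigmaOp v i = sign33 i * v i := by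
  rw [sigmaOp, sigma33_eq_diagonal, Matrix.ofLp_toEuclideanCLM, mulVec_diagonal]

theorem conj_sign33 (i : Fin 3 ⊕ Fin 3) : (starRingEnd ℂ) (sign33 i) = sign33 i := by
  rcases i with i | i <;> simp [sign33]

namespace LinearSystem

variable {a : ℝ} {H : Type*} [NormedAddCommGroup H] [InnerProductSpace ℂ H]

theorem continuousOn_expAB (sys : LinearSystem a H) : ContinuousOn sys.expAB (Ioi a) := by
  intro s₀ hs₀
  obtain ⟨s₁, h1, h2⟩ := exists_between (mem_Ioi.1 hs₀)
  have hc : ContinuousOn sys.expAB (Ici s₁) := by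
    refine ((sys.expA_cont (sys.expAB s₁)).comp (f := fun s => s - s₁) (by fun_prop)
      fun s (hs : s₁ ≤ s) => mem_Ici.2 (sub_nonneg.2 hs)).congr fun s hs => ?_
    have := sys.expAB_add _ _ (sub_nonneg.2 (mem_Ici.1 hs)) h1
    rwa [sub_add_cancel] at this
  exact (hc.continuousAt (Ici_mem_nhds h2)).continuousWithinAt

theorem continuousOn_CexpA (sys : LinearSystem a H) (h : H) :
    ContinuousOn (fun s => sys.CexpA s h) (Ioi a) := by
  intro s₀ hs₀
  obtain ⟨s₁, h1, h2⟩ := exists_between (mem_Ioi.1 hs₀)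
  have hc : ContinuousOn (fun s => sys.CexpA s h) (Ici s₁) := by
    refine ((sys.CexpA s₁).continuous.comp_continuousOn ((sys.expA_cont h).comp
      (f := fun s => s - s₁) (by fun_prop)
      fun s (hs : s₁ ≤ s) => mem_Ici.2 (sub_nonneg.2 hs))).congr fun s hs => ?_
    have := sys.CexpA_add _ _ (sub_nonneg.2 (mem_Ici.1 hs)) h1
    rw [add_sub_cancel] at this
    simp only [this, ContinuousLinearMap.comp_apply, Function.comp_apply]
  exact (hc.continuousAt (Ici_mem_nhds h2)).continuousWithinAt

variable [CompleteSpace H]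

/-- Local boundedness, from the uniform boundedness principle. -/
theorem exists_norm_CexpA_le (sys : LinearSystem a H) {x : ℝ} (y : ℝ) (hx : a < x) :
    ∃ C, ∀ s ∈ Icc x y, ‖sys.CexpA s‖ ≤ C := by
  obtain ⟨C, hC⟩ := banach_steinhaus (g := fun s : Icc x y => sys.CexpA s) fun h => by
    obtain ⟨C, hC⟩ := isCompact_Icc.exists_bound_of_continuousOn
      ((sys.continuousOn_CexpA h).mono fun s (hs : s ∈ Icc x y) => hx.trans_le hs.1)
    exact ⟨C, fun s => hC s s.2⟩
  exact ⟨C, fun s hs => hC ⟨s, hs⟩⟩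

/-- The density `e^{-sA†} C† σ C e^{-sA}` of `Q_x^σ`. -/
def densityQ (sys : LinearSystem a H) (s : ℝ) : H →L[ℂ] H :=
  (ContinuousLinearMap.adjoint (sys.CexpA s)).comp (sigmaOp.comp (sys.CexpA s))

/-- The vector `e^{-sA†} C† e_i`. -/
def rowC (sys : LinearSystem a H) (s : ℝ) (i : Fin 3 ⊕ Fin 3) : H :=
  ContinuousLinearMap.adjoint (sys.CexpA s) (EuclideanSpace.single i 1)

theorem inner_rowC (sys : LinearSystem a H) (s : ℝ) (i : Fin 3 ⊕ Fin 3) (h : H) :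
    ⟪sys.rowC s i, h⟫_ℂ = sys.CexpA s h i := by
  rw [rowC, ContinuousLinearMap.adjoint_inner_left, EuclideanSpace.inner_single_left]
  simp

theorem inner_rowC_right (sys : LinearSystem a H) (s : ℝ) (i : Fin 3 ⊕ Fin 3) (h : H) :
    ⟪h, sys.rowC s i⟫_ℂ = (starRingEnd ℂ) (sys.CexpA s h i) := by
  rw [← inner_rowC, inner_conj_symm]

theorem inner_densityQ (sys : LinearSystem a H) (s : ℝ) (h k : H) :
    ⟪k, sys.densityQ s h⟫_ℂ = ∑ i, sign33 i * (⟪k, sys.rowC s i⟫_ℂ * ⟪sys.rowC s i, h⟫_ℂ) := by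
  rw [densityQ, ContinuousLinearMap.comp_apply, ContinuousLinearMap.adjoint_inner_right,
    PiLp.inner_apply]
  refine Finset.sum_congr rfl fun i _ => ?_
  rw [ContinuousLinearMap.comp_apply, sigmaOp_apply, inner_rowC, inner_rowC_right,
    RCLike.inner_apply]
  ring

theorem densityQ_apply (sys : LinearSystem a H) (s : ℝ) (h : H) :
    sys.densityQ s h = ∑ i, (sign33 i * ⟪sys.rowC s i, h⟫_ℂ) • sys.rowC s i :=
  ext_inner_left ℂ fun k => by
    rw [inner_densityQ, inner_sum]
    refine Finset.sum_congr rfl fun i _ => ?_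
    rw [inner_smul_right]; ring

theorem continuousOn_inner_densityQ (sys : LinearSystem a H) (h k : H) :
    ContinuousOn (fun s => ⟪k, sys.densityQ s h⟫_ℂ) (Ioi a) := by
  simp only [densityQ, ContinuousLinearMap.comp_apply, ContinuousLinearMap.adjoint_inner_right]
  exact (sys.continuousOn_CexpA k).inner
    (sigmaOp.continuous.comp_continuousOn (sys.continuousOn_CexpA h))

theorem exists_norm_densityQ_le (sys : LinearSystem a H) (x y : ℝ) (hx : a < x) :
    ∃ C, ∀ s ∈ Icc x y, ‖sys.densityQ s‖ ≤ C := by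
  obtain ⟨C, hC⟩ := sys.exists_norm_CexpA_le y hx
  refine ⟨C * (‖sigmaOp‖ * C), fun s hs => ?_⟩
  have h1 := hC s hs
  have h0 : 0 ≤ C := (norm_nonneg _).trans h1
  refine (ContinuousLinearMap.opNorm_comp_le _ _).trans ?_
  rw [LinearIsometryEquiv.norm_map]
  gcongr
  exact (ContinuousLinearMap.opNorm_comp_le _ _).trans (by gcongr)

section Gramians

variable {sys : LinearSystem a H} {L Q : ℝ → H →L[ℂ] H}

theorem IsQsigma.hasWeakDerivAt (hQ : ∀ x, a < x → sys.IsQsigma x (Q x)) {x : ℝ} (hx : a < x) :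
    HasWeakDerivAt Q (-sys.densityQ x) x :=
  hasWeakDerivAt_operatorIntegral (F := sys.densityQ) hQ sys.continuousOn_inner_densityQ
    sys.exists_norm_densityQ_le hx

omit [CompleteSpace H] in
theorem IsL.hasWeakDerivAt (hL : ∀ x, a < x → sys.IsL x (L x)) {x : ℝ} (hx : a < x) :
    HasWeakDerivAt L (-InnerProductSpace.rankOne ℂ (sys.expAB x) (sys.expAB x)) x := by
  refine hasWeakDerivAt_operatorIntegral
    (F := fun s => InnerProductSpace.rankOne ℂ (sys.expAB s) (sys.expAB s)) hL (fun h k => ?_)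
    (fun x y hx => ?_) hx
  · simp only [InnerProductSpace.rankOne_apply, inner_smul_right]
    exact (sys.continuousOn_expAB.inner continuousOn_const).mul
      (continuousOn_const.inner sys.continuousOn_expAB)
  · obtain ⟨C, hC⟩ := isCompact_Icc.exists_bound_of_continuousOn
      (sys.continuousOn_expAB.mono fun s (hs : s ∈ Icc x y) => hx.trans_le hs.1)
    refine ⟨C * C, fun s hs => ?_⟩
    have h1 := hC s hs
    have h0 : 0 ≤ C := (norm_nonneg _).trans h1
    refine ContinuousLinearMap.opNorm_le_bound _ (by positivity) fun h => ?_
    rw [InnerProductSpace.rankOne_apply, norm_smul]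
    calc ‖⟪sys.expAB s, h⟫_ℂ‖ * ‖sys.expAB s‖ ≤ (C * ‖h‖) * C := by
          gcongr
          exact (norm_inner_le_norm _ _).trans (by gcongr)
      _ = _ := by ring

omit [CompleteSpace H] in
theorem IsL.inner_eq {x : ℝ} {M : H →L[ℂ] H} (hM : sys.IsL x M) (h k : H) :
    IntegrableOn (fun s => ⟪k, sys.expAB s⟫_ℂ * ⟪sys.expAB s, h⟫_ℂ) (Ioi x) ∧
      ⟪k, M h⟫_ℂ = ∫ s in Ioi x, ⟪k, sys.expAB s⟫_ℂ * ⟪sys.expAB s, h⟫_ℂ := by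
  have := hM h k
  simp only [InnerProductSpace.rankOne_apply, inner_smul_right] at this
  simpa only [mul_comm] using this

omit [CompleteSpace H] in
theorem aestronglyMeasurable_expAB (sys : LinearSystem a H) {x : ℝ} (hx : a < x) :
    AEStronglyMeasurable sys.expAB (volume.restrict (Ioi x)) :=
  (sys.continuousOn_expAB.mono (Ioi_subset_Ioi hx.le)).aestronglyMeasurable measurableSet_Ioi

theorem IsL.integrableOn_norm_sq [TopologicalSpace.SeparableSpace H] {x : ℝ} {M : H →L[ℂ] H}
    (hM : sys.IsL x M) (hx : a < x) (htr : IsTraceClass M) :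
    IntegrableOn (fun s => ‖sys.expAB s‖ ^ 2) (Ioi x) :=
  integrable_norm_sq_of_isTraceClass (sys.aestronglyMeasurable_expAB hx) htr
    fun h => hM.inner_eq h h

theorem IsL.adjoint_eq {x : ℝ} {M : H →L[ℂ] H} (hM : sys.IsL x M) :
    ContinuousLinearMap.adjoint M = M := by
  refine ContinuousLinearMap.ext fun h => ext_inner_left ℂ fun k => ?_
  rw [ContinuousLinearMap.adjoint_inner_right, ← inner_conj_symm, (hM.inner_eq _ _).2,
    (hM.inner_eq _ _).2, ← integral_conj]
  simp only [map_mul, inner_conj_symm, mul_comm]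

theorem IsQsigma.adjoint_eq {x : ℝ} {M : H →L[ℂ] H} (hM : sys.IsQsigma x M) :
    ContinuousLinearMap.adjoint M = M := by
  refine ContinuousLinearMap.ext fun h => ext_inner_left ℂ fun k => ?_
  have h1 : ∀ h k, ⟪k, M h⟫_ℂ = ∫ s in Ioi x, ⟪k, sys.densityQ s h⟫_ℂ := fun h k => (hM h k).2
  rw [ContinuousLinearMap.adjoint_inner_right, ← inner_conj_symm, h1, h1, ← integral_conj]
  simp only [inner_densityQ, map_sum, map_mul, inner_conj_symm, conj_sign33, mul_comm]

end Gramians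

end LinearSystem

/-! ### The logarithmic derivative of the determinant -/

section Resolvent

open Filter Topology

variable {H : Type*} [NormedAddCommGroup H] [InnerProductSpace ℂ H] [CompleteSpace H]

theorem isUnit_one_sub_smul {Z : H →L[ℂ] H} (hZ : ‖Z‖ < 1) {t : ℝ} (ht : t ∈ Icc (0 : ℝ) 1) :
    IsUnit (1 - (t : ℂ) • Z) :=
  isUnit_one_sub_of_norm_lt_one (norm_smul_mul_lt_one ht hZ)

omit [CompleteSpace H] in
/-- `N = I + c Z N` for the resolvent `N = (I - c Z)⁻¹`. -/
theorem inverse_eq_one_add_mul {Z : H →L[ℂ] H} {c : ℂ} (hu : IsUnit (1 - c • Z)) :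
    Ring.inverse (1 - c • Z) = 1 + c • (Z * Ring.inverse (1 - c • Z)) := by
  have h := Ring.mul_inverse_cancel _ hu
  rw [sub_mul, one_mul, smul_mul_assoc] at h
  exact sub_eq_iff_eq_add.1 h

omit [CompleteSpace H] in
/-- `N = I + c N Z` for the resolvent `N = (I - c Z)⁻¹`. -/
theorem inverse_eq_one_add_mul' {Z : H →L[ℂ] H} {c : ℂ} (hu : IsUnit (1 - c • Z)) :
    Ring.inverse (1 - c • Z) = 1 + c • (Ring.inverse (1 - c • Z) * Z) := by
  have h := Ring.inverse_mul_cancel _ hu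
  rw [mul_sub, mul_one, mul_smul_comm] at h
  exact sub_eq_iff_eq_add.1 h

omit [CompleteSpace H] in
/-- `Q (I - c L Q)⁻¹ = (I - c Q L)⁻¹ Q`. -/
theorem mul_inverse_one_sub_comm {L Q : H →L[ℂ] H} {c : ℂ} (h1 : IsUnit (1 - c • (L * Q)))
    (h2 : IsUnit (1 - c • (Q * L))) :
    Q * Ring.inverse (1 - c • (L * Q)) = Ring.inverse (1 - c • (Q * L)) * Q := by
  have h : (1 - c • (Q * L)) * Q = Q * (1 - c • (L * Q)) := by
    rw [sub_mul, mul_sub, one_mul, mul_one, smul_mul_assoc, mul_smul_comm, mul_assoc]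
  calc Q * Ring.inverse (1 - c • (L * Q))
      = Ring.inverse (1 - c • (Q * L)) * ((1 - c • (Q * L)) * Q) *
          Ring.inverse (1 - c • (L * Q)) := by
        rw [← mul_assoc, Ring.inverse_mul_cancel _ h2, one_mul]
    _ = Ring.inverse (1 - c • (Q * L)) * Q := by
        rw [h, mul_assoc, mul_assoc, Ring.mul_inverse_cancel _ h1, mul_one]

theorem norm_inverse_one_sub_le {Z : H →L[ℂ] H} {ρ : ℝ} (hZ : ‖Z‖ ≤ ρ) (hρ : ρ < 1) {t : ℝ}
    (ht : t ∈ Icc (0 : ℝ) 1) : ‖Ring.inverse (1 - (t : ℂ) • Z)‖ ≤ (1 - ρ)⁻¹ := by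
  set N := Ring.inverse (1 - (t : ℂ) • Z) with hN
  have h1 : N = 1 + (t : ℂ) • (Z * N) :=
    inverse_eq_one_add_mul (isUnit_one_sub_smul (hZ.trans_lt hρ) ht)
  have h2 : ‖N‖ ≤ 1 + ρ * ‖N‖ := by
    calc ‖N‖ = ‖1 + (t : ℂ) • (Z * N)‖ := by rw [← h1]
      _ ≤ 1 + 1 * (‖Z‖ * ‖N‖) := by
          refine (norm_add_le _ _).trans (add_le_add ContinuousLinearMap.norm_id_le ?_)
          rw [norm_smul, Complex.norm_real, Real.norm_of_nonneg ht.1]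
          exact mul_le_mul ht.2 (norm_mul_le _ _) (norm_nonneg _) zero_le_one
      _ ≤ 1 + ρ * ‖N‖ := by rw [one_mul]; gcongr
  rw [← one_div, le_div_iff₀ (by linarith)]
  linarith

/-- `d/dt (t N) = N²` for the resolvent `N = (I - t Z)⁻¹`, integrated over `[0, 1]`. -/
theorem integral_inner_inverse_sq {Z : H →L[ℂ] H} (hZ : ‖Z‖ < 1) (h k : H) :
    ∫ t in (0 : ℝ)..1, ⟪k, (Ring.inverse (1 - (t : ℂ) • Z) * Ring.inverse (1 - (t : ℂ) • Z)) h⟫_ℂ =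
      ⟪k, Ring.inverse (1 - Z) h⟫_ℂ := by
  have hcont := continuousOn_inverse_one_sub_smul hZ
  have hw : ∀ t ∈ Icc (0 : ℝ) 1, HasDerivAt
      (fun t : ℝ => (t : ℂ) * ⟪k, Ring.inverse (1 - (t : ℂ) • Z) h⟫_ℂ)
      ⟪k, (Ring.inverse (1 - (t : ℂ) • Z) * Ring.inverse (1 - (t : ℂ) • Z)) h⟫_ℂ t := fun t ht => by
    have hu := isUnit_one_sub_smul hZ ht
    have h0 : HasWeakDerivAt (fun t : ℝ => 1 - (t : ℂ) • Z) (-Z) t :=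
      { isBigO := by
          refine Asymptotics.IsBigO.of_bound ‖Z‖ (Eventually.of_forall fun u => le_of_eq ?_)
          have : (1 - (u : ℂ) • Z) - (1 - (t : ℂ) • Z) = ((t - u : ℝ) : ℂ) • Z := by
            push_cast; module
          rw [this, norm_smul, Complex.norm_real, mul_comm, ← neg_sub, norm_neg]
        weak := fun h k => by
          have h1 : HasDerivAt (fun u : ℝ => (u : ℂ)) 1 t := by
            simpa using (hasDerivAt_id t).ofReal_comp
          have h2 := (h1.mul_const ⟪k, Z h⟫_ℂ).const_sub ⟪k, h⟫_ℂ
          refine (h2.congr_of_eventuallyEq (Eventually.of_forall fun u => ?_)).congr_deriv ?_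
          · simp only [_root_.sub_apply, _root_.smul_apply, one_apply_eq_self, inner_sub_right,
              inner_smul_right]
          · simp }
    have h1 := (h0.ringInverse hu).weak h k
    have h2 : HasDerivAt (fun u : ℝ => (u : ℂ)) 1 t := by
      simpa using (hasDerivAt_id t).ofReal_comp
    refine (h2.mul h1).congr_deriv ?_
    set N := Ring.inverse (1 - (t : ℂ) • Z) with hN
    have h3 : N = 1 + (t : ℂ) • (N * Z) := inverse_eq_one_add_mul' hu
    have h4 : N * N = N + (t : ℂ) • (N * Z * N) := by
      nth_rewrite 1 [h3]
      rw [add_mul, one_mul, smul_mul_assoc]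
    rw [h4, _root_.add_apply, _root_.smul_apply, inner_add_right, inner_smul_right, one_mul]
    simp
  rw [intervalIntegral.integral_eq_sub_of_hasDerivAt (fun t ht => hw t (by
    rwa [uIcc_of_le zero_le_one] at ht))]
  · simp
  · refine ContinuousOn.intervalIntegrable ?_
    rw [uIcc_of_le zero_le_one]
    exact continuousOn_const.inner ((hcont.mul hcont).clm_apply continuousOn_const)

variable {α : Type*} [MeasurableSpace α] {μ : Measure α} {b : α → H} {L : H →L[ℂ] H}

theorem gramTrace_mul_rankOne_mul
    (hL : ∀ h k, ⟪k, L h⟫_ℂ = ∫ s, ⟪k, b s⟫_ℂ * ⟪b s, h⟫_ℂ ∂μ) (X Y : H →L[ℂ] H) (p q : H) :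
    gramTrace μ b (X * InnerProductSpace.rankOne ℂ p q * Y) = ⟪q, Y (L (X p))⟫_ℂ := by
  rw [← ContinuousLinearMap.adjoint_inner_left, hL, gramTrace]
  refine integral_congr_ae (Eventually.of_forall fun s => ?_)
  simp only [mul_apply_eq_comp, InnerProductSpace.rankOne_apply, map_smul, inner_smul_right,
    ContinuousLinearMap.adjoint_inner_left]

omit [CompleteSpace H] in
theorem gramTrace_add (hb : AEStronglyMeasurable b μ) (hb2 : Integrable (fun s => ‖b s‖ ^ 2) μ)
    (X Y : H →L[ℂ] H) : gramTrace μ b (X + Y) = gramTrace μ b X + gramTrace μ b Y := by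
  rw [gramTrace, gramTrace, gramTrace, ← integral_add (integrable_inner_apply hb hb2 X)
    (integrable_inner_apply hb hb2 Y)]
  simp only [_root_.add_apply, inner_add_right]

omit [CompleteSpace H] in
theorem gramTrace_smul (c : ℂ) (X : H →L[ℂ] H) :
    gramTrace μ b (c • X) = c * gramTrace μ b X := by
  rw [gramTrace, gramTrace, ← integral_const_mul]
  simp only [_root_.smul_apply, inner_smul_right]

omit [CompleteSpace H] in
theorem gramTrace_sub (hb : AEStronglyMeasurable b μ) (hb2 : Integrable (fun s => ‖b s‖ ^ 2) μ)
    (X Y : H →L[ℂ] H) : gramTrace μ b (X - Y) = gramTrace μ b X - gramTrace μ b Y := by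
  rw [gramTrace, gramTrace, gramTrace, ← integral_sub (integrable_inner_apply hb hb2 X)
    (integrable_inner_apply hb hb2 Y)]
  simp only [_root_.sub_apply, inner_sub_right]

omit [CompleteSpace H] in
theorem gramTrace_sum {ι : Type*} (F : Finset ι) (hb : AEStronglyMeasurable b μ)
    (hb2 : Integrable (fun s => ‖b s‖ ^ 2) μ) (X : ι → H →L[ℂ] H) :
    gramTrace μ b (∑ i ∈ F, X i) = ∑ i ∈ F, gramTrace μ b (X i) := by
  simp only [gramTrace, _root_.sum_apply, inner_sum]
  exact integral_finsetSum _ fun i _ => integrable_inner_apply hb hb2 _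

end Resolvent

namespace LinearSystem

open Filter Topology Asymptotics

variable {a : ℝ} {H : Type*} [NormedAddCommGroup H] [InnerProductSpace ℂ H]

theorem integrableOn_inner_apply {sys : LinearSystem a H}
    (hb2 : ∀ x, a < x → IntegrableOn (fun s => ‖sys.expAB s‖ ^ 2) (Ioi x)) (X : H →L[ℂ] H)
    (x : ℝ) (hx : a < x) : IntegrableOn (fun s => ⟪sys.expAB s, X (sys.expAB s)⟫_ℂ) (Ioi x) :=
  integrable_inner_apply (sys.aestronglyMeasurable_expAB hx) (hb2 x hx) X

theorem exists_norm_gramTrace_sub_le (sys : LinearSystem a H)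
    (hb2 : ∀ x, a < x → IntegrableOn (fun s => ‖sys.expAB s‖ ^ 2) (Ioi x)) {x₀ : ℝ}
    (hx₀ : a < x₀) :
    ∃ C, 0 ≤ C ∧ ∀ᶠ x in 𝓝 x₀, a < x ∧ ∀ X : H →L[ℂ] H,
      ‖gramTrace (volume.restrict (Ioi x)) sys.expAB X -
        gramTrace (volume.restrict (Ioi x₀)) sys.expAB X‖ ≤ C * ‖X‖ * |x - x₀| := by
  obtain ⟨x₁, hx₁, hx₁'⟩ := exists_between hx₀
  obtain ⟨C, hC⟩ := isCompact_Icc.exists_bound_of_continuousOn (sys.continuousOn_expAB.mono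
    fun s (hs : s ∈ Icc x₁ (x₀ + 1)) => hx₁.trans_le hs.1)
  have hC0 : 0 ≤ C := (norm_nonneg _).trans (hC x₀ ⟨hx₁'.le, by linarith⟩)
  refine ⟨C * C, by positivity, ?_⟩
  filter_upwards [Icc_mem_nhds hx₁' (lt_add_one x₀)] with x hx
  have hax : a < x := hx₁.trans_le hx.1
  refine ⟨hax, fun X => ?_⟩
  rw [gramTrace, gramTrace,
    integral_Ioi_sub_integral_Ioi_eq (integrableOn_inner_apply hb2 X) hax hx₀, norm_neg]
  refine intervalIntegral.norm_integral_le_of_norm_le_const fun s hs => ?_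
  have h1 := hC s (uIcc_subset_Icc ⟨hx₁'.le, by linarith⟩ hx (uIoc_subset_uIcc hs))
  calc ‖⟪sys.expAB s, X (sys.expAB s)⟫_ℂ‖ ≤ C * (‖X‖ * C) :=
        (norm_inner_le_norm _ _).trans (by
          gcongr
          exact (X.le_opNorm _).trans (by gcongr))
    _ = _ := by ring

/-- The trace depends on `x` through the half line of integration and through the operator. -/
theorem hasDerivAt_gramTrace_Ioi (sys : LinearSystem a H)
    (hb2 : ∀ x, a < x → IntegrableOn (fun s => ‖sys.expAB s‖ ^ 2) (Ioi x))
    {T : ℝ → H →L[ℂ] H} {T' : H →L[ℂ] H} {x₀ : ℝ} (hx₀ : a < x₀) (hT : HasWeakDerivAt T T' x₀) :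
    HasDerivAt (fun x => gramTrace (volume.restrict (Ioi x)) sys.expAB (T x))
      (gramTrace (volume.restrict (Ioi x₀)) sys.expAB T' -
        ⟪sys.expAB x₀, T x₀ (sys.expAB x₀)⟫_ℂ) x₀ := by
  have hbm := sys.aestronglyMeasurable_expAB hx₀
  have h1 := hT.hasDerivAt_gramTrace hbm (hb2 x₀ hx₀)
  have h2 : HasDerivAt (fun x => gramTrace (volume.restrict (Ioi x)) sys.expAB (T x₀))
      (-⟪sys.expAB x₀, T x₀ (sys.expAB x₀)⟫_ℂ) x₀ :=
    hasDerivAt_integral_Ioi (sys.continuousOn_expAB.inner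
      ((T x₀).continuous.comp_continuousOn sys.continuousOn_expAB))
      (integrableOn_inner_apply hb2 _) hx₀
  obtain ⟨C, hC0, hC⟩ := sys.exists_norm_gramTrace_sub_le hb2 hx₀
  obtain ⟨K, hK⟩ := hT.isBigO.bound
  -- The mixed increment, where both the half line and the operator move, is `O((x - x₀)²)`.
  have h3 : HasDerivAt (fun x => gramTrace (volume.restrict (Ioi x)) sys.expAB (T x - T x₀) -
      gramTrace (volume.restrict (Ioi x₀)) sys.expAB (T x - T x₀)) 0 x₀ := by
    rw [hasDerivAt_iff_isLittleO]
    simp only [sub_self, smul_zero, sub_zero]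
    refine IsBigO.trans_isLittleO (g := fun x : ℝ => (x - x₀) ^ 2) ?_
      (by simpa only [Real.norm_eq_abs, sq_abs] using isLittleO_pow_sub_sub x₀ one_lt_two)
    refine IsBigO.of_bound (C * K) ?_
    filter_upwards [hC, hK] with x hx hx'
    refine (hx.2 _).trans ?_
    rw [Real.norm_eq_abs] at hx'
    rw [norm_pow, Real.norm_eq_abs]
    calc C * ‖T x - T x₀‖ * |x - x₀| ≤ C * (K * |x - x₀|) * |x - x₀| := by gcongr
      _ = _ := by ring
  refine (((h1.add h2).add h3).sub_const
    (gramTrace (volume.restrict (Ioi x₀)) sys.expAB (T x₀))).congr_of_eventuallyEq ?_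
    |>.congr_deriv (by ring)
  filter_upwards [Ioi_mem_nhds hx₀] with x hx
  simp only [Pi.add_apply]
  rw [gramTrace_sub (sys.aestronglyMeasurable_expAB hx) (hb2 x hx),
    gramTrace_sub hbm (hb2 x₀ hx₀)]
  ring

variable [CompleteSpace H] {sys : LinearSystem a H} {L Q : ℝ → H →L[ℂ] H}

/-- The operator `Q (I - t L Q)⁻¹` and the derivative of its trace against `L`. The two terms come
from `L' = -b b†`, where `b = e^{-xA} B`, and from `Q' = -e^{-xA†} C† σ C e^{-xA}`. -/
theorem hasDerivAt_gramTrace_resolvent (hL : ∀ x, a < x → sys.IsL x (L x))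
    (hQ : ∀ x, a < x → sys.IsQsigma x (Q x))
    (hb2 : ∀ x, a < x → IntegrableOn (fun s => ‖sys.expAB s‖ ^ 2) (Ioi x)) {x : ℝ} (hx : a < x)
    (hLQ : ‖L x * Q x‖ < 1) {t : ℝ} (ht : t ∈ Icc (0 : ℝ) 1) :
    HasDerivAt (fun y => gramTrace (volume.restrict (Ioi y)) sys.expAB
        (Q y * Ring.inverse (1 - (t : ℂ) • (L y * Q y))))
      (-(⟪sys.expAB x, Q x ((Ring.inverse (1 - (t : ℂ) • (L x * Q x)) *
          Ring.inverse (1 - (t : ℂ) • (L x * Q x))) (sys.expAB x))⟫_ℂ +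
        ∑ i, sign33 i * ⟪sys.rowC x i, (Ring.inverse (1 - (t : ℂ) • (L x * Q x)) *
          Ring.inverse (1 - (t : ℂ) • (L x * Q x))) (L x (sys.rowC x i))⟫_ℂ)) x := by
  have hu := isUnit_one_sub_smul hLQ ht
  have hwL := IsL.hasWeakDerivAt hL hx
  have hwQ := IsQsigma.hasWeakDerivAt hQ hx
  have hw := hwQ.mul (((hwL.mul hwQ).const_sub_smul 1 (t : ℂ)).ringInverse hu)
  refine (sys.hasDerivAt_gramTrace_Ioi hb2 hx hw).congr_deriv ?_
  set N := Ring.inverse (1 - (t : ℂ) • (L x * Q x)) with hN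
  set b := sys.expAB x with hb
  have hbm := sys.aestronglyMeasurable_expAB hx
  have hLk : ∀ h k, ⟪k, L x h⟫_ℂ =
      ∫ s, ⟪k, sys.expAB s⟫_ℂ * ⟪sys.expAB s, h⟫_ℂ ∂(volume.restrict (Ioi x)) :=
    fun h k => ((hL x hx).inner_eq h k).2
  have hN1 : N = 1 + (t : ℂ) • (L x * Q x * N) := inverse_eq_one_add_mul hu
  have hN2 : N * N = N + (t : ℂ) • (N * L x * Q x * N) := by
    nth_rewrite 2 [hN1]
    rw [mul_add, mul_one, mul_smul_comm]
    simp only [mul_assoc]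
  have hsplit : -sys.densityQ x * N + Q x * -(N * -((t : ℂ) •
      (-InnerProductSpace.rankOne ℂ b b * Q x + L x * -sys.densityQ x)) * N) =
      (-1 : ℂ) • ((1 + (t : ℂ) • (Q x * N * L x)) * sys.densityQ x * N) +
        (-(t : ℂ)) • (Q x * N * InnerProductSpace.rankOne ℂ b b * (Q x * N)) := by
    simp only [neg_mul, mul_neg, neg_neg, smul_add, mul_add, add_mul, mul_smul_comm,
      smul_mul_assoc, smul_neg, neg_smul, one_smul, one_mul, mul_assoc]
    abel
  have hdens : ∀ X Y : H →L[ℂ] H, gramTrace (volume.restrict (Ioi x)) sys.expAB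
      (X * sys.densityQ x * Y) =
      ∑ i, sign33 i * ⟪sys.rowC x i, Y (L x (X (sys.rowC x i)))⟫_ℂ := fun X Y => by
    have : X * sys.densityQ x * Y = ∑ i, sign33 i •
        (X * InnerProductSpace.rankOne ℂ (sys.rowC x i) (sys.rowC x i) * Y) := by
      ext h
      simp only [mul_apply_eq_comp, densityQ_apply, map_sum, map_smul, _root_.sum_apply,
        _root_.smul_apply, InnerProductSpace.rankOne_apply, smul_smul]
    rw [this, gramTrace_sum _ hbm (hb2 x hx)]
    refine Finset.sum_congr rfl fun i _ => ?_
    rw [gramTrace_smul, gramTrace_mul_rankOne_mul hLk]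
  rw [hsplit, gramTrace_add hbm (hb2 x hx), gramTrace_smul, gramTrace_smul, hdens,
    gramTrace_mul_rankOne_mul hLk]
  have e1 : ∀ h, N (L x ((1 + (t : ℂ) • (Q x * N * L x)) h)) = (N * N) (L x h) := fun h => by
    rw [hN2]
    simp only [_root_.add_apply, _root_.smul_apply, one_apply_eq_self, mul_apply_eq_comp, map_add,
      map_smul]
  have e2 : Q x ((N * N) b) = Q x (N b) + (t : ℂ) • (Q x * N) (L x ((Q x * N) b)) := by
    rw [hN2]
    simp only [_root_.add_apply, _root_.smul_apply, mul_apply_eq_comp, map_add, map_smul]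
  simp only [e1]
  rw [e2, inner_add_right, inner_smul_right]
  simp only [mul_apply_eq_comp]
  ring

/-- Differentiation of `∫₀¹ tr (L Q (I - t L Q)⁻¹) dt`: the derivative of the integrand contains
`N² = (I - t L Q)⁻²`, and `∫₀¹ N² dt = (I - L Q)⁻¹`. -/
theorem hasDerivAt_integral_gramTrace_resolvent (hL : ∀ x, a < x → sys.IsL x (L x))
    (hQ : ∀ x, a < x → sys.IsQsigma x (Q x))
    (hb2 : ∀ x, a < x → IntegrableOn (fun s => ‖sys.expAB s‖ ^ 2) (Ioi x))
    (hLQ : ∀ x, a < x → ‖L x * Q x‖ < 1) {x : ℝ} (hx : a < x) :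
    HasDerivAt (fun y => ∫ t in (0 : ℝ)..1, gramTrace (volume.restrict (Ioi y)) sys.expAB
        (Q y * Ring.inverse (1 - (t : ℂ) • (L y * Q y))))
      (-(⟪sys.expAB x, Q x (Ring.inverse (1 - L x * Q x) (sys.expAB x))⟫_ℂ +
        ∑ i, sign33 i * ⟪sys.rowC x i,
          Ring.inverse (1 - L x * Q x) (L x (sys.rowC x i))⟫_ℂ)) x := by
  have hwL := IsL.hasWeakDerivAt hL hx
  have hwQ := IsQsigma.hasWeakDerivAt hQ hx
  have hwZ := hwL.mul hwQ
  obtain ⟨ρ, hρ, hρ1⟩ := exists_between (hLQ x hx)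
  have hρ' : ∀ᶠ y in 𝓝 x, ‖L y * Q y‖ < ρ := hwZ.continuousAt.norm.eventually_lt_const hρ
  have hq' : ∀ᶠ y in 𝓝 x, ‖Q y‖ < ‖Q x‖ + 1 :=
    hwQ.continuousAt.norm.eventually_lt_const (lt_add_one _)
  obtain ⟨CZ, hCZ⟩ := hwZ.isBigO.bound
  obtain ⟨CQ, hCQ⟩ := hwQ.isBigO.bound
  obtain ⟨C, hC0, hC⟩ := sys.exists_norm_gramTrace_sub_le hb2 hx
  set M := ∫ s in Ioi x, ‖sys.expAB s‖ ^ 2 with hM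
  have hM0 : 0 ≤ M := integral_nonneg fun _ => by positivity
  set κ := (1 - ρ)⁻¹ with hκ
  have hκ0 : 0 ≤ κ := inv_nonneg.2 (by linarith)
  set q := ‖Q x‖ + 1 with hq
  have hq0 : 0 ≤ q := by positivity
  have hev := hρ'.and (hq'.and (hCZ.and (hCQ.and hC)))
  simp only [intervalIntegral.integral_of_le (zero_le_one' ℝ)]
  have hmain := hasDerivAt_integral_of_norm_sub_le (μ := volume.restrict (Ioc (0 : ℝ) 1))
    (F := fun y t => gramTrace (volume.restrict (Ioi y)) sys.expAB
        (Q y * Ring.inverse (1 - (t : ℂ) • (L y * Q y))))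
    (F' := fun t => -(⟪sys.expAB x, Q x ((Ring.inverse (1 - (t : ℂ) • (L x * Q x)) *
          Ring.inverse (1 - (t : ℂ) • (L x * Q x))) (sys.expAB x))⟫_ℂ +
        ∑ i, sign33 i * ⟪sys.rowC x i, (Ring.inverse (1 - (t : ℂ) • (L x * Q x)) *
          Ring.inverse (1 - (t : ℂ) • (L x * Q x))) (L x (sys.rowC x i))⟫_ℂ))
    (bound := fun _ => C * (q * κ) + M * (CQ * κ + q * (κ * CZ * κ))) (x₀ := x) hev
    ?_ ?_ ?_ ?_ ?_ ?_
  · refine hmain.congr_deriv ?_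
    have hcont := continuousOn_inverse_one_sub_smul (hLQ x hx)
    have hci : ∀ h k, IntervalIntegrable (fun t : ℝ => ⟪k, (Ring.inverse (1 - (t : ℂ) •
        (L x * Q x)) * Ring.inverse (1 - (t : ℂ) • (L x * Q x))) h⟫_ℂ) volume 0 1 := fun h k => by
      refine ContinuousOn.intervalIntegrable ?_
      rw [uIcc_of_le zero_le_one]
      exact continuousOn_const.inner ((hcont.mul hcont).clm_apply continuousOn_const)
    rw [← intervalIntegral.integral_of_le zero_le_one, intervalIntegral.integral_neg]
    simp only [← ContinuousLinearMap.adjoint_inner_left (Q x)]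
    have hcs : IntervalIntegrable (fun t : ℝ => ∑ i, sign33 i * ⟪sys.rowC x i,
        (Ring.inverse (1 - (t : ℂ) • (L x * Q x)) * Ring.inverse (1 - (t : ℂ) • (L x * Q x)))
          (L x (sys.rowC x i))⟫_ℂ) volume 0 1 := by
      simpa only [Finset.sum_fn] using IntervalIntegrable.sum Finset.univ fun i _ =>
        (hci (L x (sys.rowC x i)) (sys.rowC x i)).const_mul (sign33 i)
    rw [intervalIntegral.integral_add (hci _ _) hcs, intervalIntegral.integral_finsetSum fun i _ =>
        (hci _ _).const_mul _]
    simp only [intervalIntegral.integral_const_mul, integral_inner_inverse_sq (hLQ x hx)]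
  · rintro y ⟨hy, -, -, -, hay, -⟩
    exact ((continuousOn_gramTrace_resolvent (sys.aestronglyMeasurable_expAB hay) (hb2 y hay)
      (hLQ y hay)).mono Ioc_subset_Icc_self).aestronglyMeasurable measurableSet_Ioc
  · exact (continuousOn_gramTrace_resolvent (sys.aestronglyMeasurable_expAB hx) (hb2 x hx)
      (hLQ x hx)).integrableOn_Icc.mono_set Ioc_subset_Icc_self
  · refine ContinuousOn.aestronglyMeasurable ?_ measurableSet_Ioc
    have hcont := (continuousOn_inverse_one_sub_smul (hLQ x hx)).mono Ioc_subset_Icc_self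
    refine ContinuousOn.neg (ContinuousOn.add (continuousOn_const.inner
      ((Q x).continuous.comp_continuousOn ((hcont.mul hcont).clm_apply continuousOn_const)))
      (continuousOn_finsetSum _ fun i _ => continuousOn_const.mul (continuousOn_const.inner
        ((hcont.mul hcont).clm_apply continuousOn_const))))
  · refine ae_restrict_of_forall_mem measurableSet_Ioc fun t ht y hy => ?_
    obtain ⟨hy1, hy2, hy3, hy4, hay, hy5⟩ := hy
    have ht' := Ioc_subset_Icc_self ht
    have hNy := norm_inverse_one_sub_le hy1.le hρ1 ht'
    have hNx := norm_inverse_one_sub_le hρ.le hρ1 ht'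
    have huy := isUnit_one_sub_smul (hLQ y hay) ht'
    have hux := isUnit_one_sub_smul (hLQ x hx) ht'
    have hy3' : ‖L y * Q y - L x * Q x‖ ≤ CZ * |y - x| := hy3
    have hy4' : ‖Q y - Q x‖ ≤ CQ * |y - x| := hy4
    set Ny := Ring.inverse (1 - (t : ℂ) • (L y * Q y)) with hNy_def
    set Nx := Ring.inverse (1 - (t : ℂ) • (L x * Q x)) with hNx_def
    have hNd : Ny - Nx = (t : ℂ) • (Ny * (L y * Q y - L x * Q x) * Nx) := by
      have h1 : Ny * (1 - (t : ℂ) • (L y * Q y)) = 1 := Ring.inverse_mul_cancel _ huy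
      have h2 : (1 - (t : ℂ) • (L x * Q x)) * Nx = 1 := Ring.mul_inverse_cancel _ hux
      calc Ny - Nx = Ny * ((1 - (t : ℂ) • (L x * Q x)) * Nx) -
            (Ny * (1 - (t : ℂ) • (L y * Q y))) * Nx := by rw [h1, h2, mul_one, one_mul]
        _ = _ := by
          simp only [mul_sub, sub_mul, mul_one, one_mul, mul_smul_comm, smul_mul_assoc, smul_sub,
            mul_assoc]
          abel
    have hNd' : ‖Ny - Nx‖ ≤ κ * (CZ * |y - x|) * κ := by
      rw [hNd, norm_smul, Complex.norm_real, Real.norm_of_nonneg ht'.1]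
      calc t * ‖Ny * (L y * Q y - L x * Q x) * Nx‖
          ≤ 1 * (‖Ny‖ * ‖L y * Q y - L x * Q x‖ * ‖Nx‖) := by
            gcongr
            · exact ht'.2
            · exact (norm_mul_le _ _).trans (by gcongr; exact norm_mul_le _ _)
        _ ≤ _ := by
            rw [one_mul]
            gcongr
            exact mul_nonneg hκ0 ((norm_nonneg _).trans hy3')
    have hR : ‖Q y * Ny - Q x * Nx‖ ≤ (CQ * |y - x|) * κ + q * (κ * (CZ * |y - x|) * κ) := by
      have : Q y * Ny - Q x * Nx = (Q y - Q x) * Ny + Q x * (Ny - Nx) := by noncomm_ring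
      rw [this]
      refine (norm_add_le _ _).trans (add_le_add ?_ ?_)
      · exact (norm_mul_le _ _).trans
          (mul_le_mul hy4' hNy (norm_nonneg _) ((norm_nonneg _).trans hy4'))
      · exact (norm_mul_le _ _).trans
          (mul_le_mul (by linarith) hNd' (norm_nonneg _) hq0)
    have hRy : ‖Q y * Ny‖ ≤ q * κ := (norm_mul_le _ _).trans
      (mul_le_mul hy2.le hNy (norm_nonneg _) hq0)
    have h1 := hy5 (Q y * Ny)
    have h2 := norm_gramTrace_sub_le (sys.aestronglyMeasurable_expAB hx) (hb2 x hx) (Q y * Ny)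
      (Q x * Nx)
    calc ‖gramTrace (volume.restrict (Ioi y)) sys.expAB (Q y * Ny) -
          gramTrace (volume.restrict (Ioi x)) sys.expAB (Q x * Nx)‖
        ≤ C * ‖Q y * Ny‖ * |y - x| + M * ‖Q y * Ny - Q x * Nx‖ :=
          (norm_sub_le_norm_sub_add_norm_sub _ _ _).trans (add_le_add h1 h2)
      _ ≤ C * (q * κ) * |y - x| +
          M * ((CQ * |y - x|) * κ + q * (κ * (CZ * |y - x|) * κ)) := by gcongr
      _ = _ := by ring
  · exact integrable_const _
  · exact ae_restrict_of_forall_mem measurableSet_Ioc fun t ht =>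
      hasDerivAt_gramTrace_resolvent hL hQ hb2 hx (hLQ x hx) (Ioc_subset_Icc_self ht)

end LinearSystem

/-! ### The Lax pair and the kernel as a product of Hankel operators -/

namespace PVIParams

open Filter Topology

variable {p : PVIParams} {Φ : ℝ → Fin 2 → ℝ} {V : Fin 3 → Matrix (Fin 2) (Fin 2) ℝ}

/-- The indefinite form `φ(x)† σ_{3,3} φ(y)`. -/
def symbolForm (p : PVIParams) (V : Fin 3 → Matrix (Fin 2) (Fin 2) ℝ) (Φ : ℝ → Fin 2 → ℝ)
    (x y : ℝ) : ℝ :=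
  ∑ ν, (p.symbol V Φ x (Sum.inl ν) * p.symbol V Φ y (Sum.inl ν) -
    p.symbol V Φ x (Sum.inr ν) * p.symbol V Φ y (Sum.inr ν))

theorem sub_pole_pos (p : PVIParams) {x : ℝ} (hx : p.t < x) (ν : Fin 3) : 0 < x - p.pole ν := by
  have := p.one_lt_t
  fin_cases ν <;> simp [pole] <;> linarith

theorem W_one_one (p : PVIParams) (ν : Fin 3) : p.W ν 1 1 = -p.W ν 0 0 := by
  simp [W]; ring

theorem coeff_apply (p : PVIParams) (x : ℝ) (i j : Fin 2) :
    p.coeff x i j = ∑ ν, (x - p.pole ν)⁻¹ * p.W ν i j := by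
  simp [coeff, Matrix.sum_apply]

theorem coeff_one_one (p : PVIParams) (x : ℝ) : p.coeff x 1 1 = -p.coeff x 0 0 := by
  simp only [coeff_apply, W_one_one, mul_neg, Finset.sum_neg_distrib]

/-- The form `φ(x)† σ φ(y)` in terms of `J W_ν = V_ν† diag (1, -1) V_ν`. -/
theorem symbolForm_eq (hV : p.IsFactorization V) (x y : ℝ) :
    p.symbolForm V Φ x y = ∑ ν, (x - p.pole ν)⁻¹ * (y - p.pole ν)⁻¹ *
      (-p.W ν 1 0 * (Φ x 0 * Φ y 0) + p.W ν 0 0 * (Φ x 0 * Φ y 1 + Φ x 1 * Φ y 0) +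
        p.W ν 0 1 * (Φ x 1 * Φ y 1)) := by
  refine Finset.sum_congr rfl fun ν _ => ?_
  have h := hV ν
  have h00 : -p.W ν 1 0 = V ν 0 0 ^ 2 - V ν 1 0 ^ 2 := by
    have := congrFun (congrFun h 0) 0
    simp [J, Matrix.mul_apply, Fin.sum_univ_two] at this
    linarith
  have h01 : p.W ν 0 0 = V ν 0 0 * V ν 0 1 - V ν 1 0 * V ν 1 1 := by
    have := congrFun (congrFun h 1) 0
    simp [J, Matrix.mul_apply, Fin.sum_univ_two] at this
    linarith
  have h11 : p.W ν 0 1 = V ν 0 1 ^ 2 - V ν 1 1 ^ 2 := by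
    have := congrFun (congrFun h 1) 1
    simp [J, Matrix.mul_apply, Fin.sum_univ_two] at this
    linarith
  rw [h00, h01, h11]
  simp only [symbol, Sum.elim_inl, Sum.elim_inr, mulVec, dotProduct, Fin.sum_univ_two]
  ring

theorem IsSolution.hasDerivAt_zero (hΦ : p.IsSolution Φ) {x : ℝ} (hx : p.t < x) :
    HasDerivAt (fun x => Φ x 0) (p.coeff x 0 0 * Φ x 0 + p.coeff x 0 1 * Φ x 1) x := by
  have := hasDerivAt_pi.1 (hΦ.ode x hx) 0
  simpa [mulVec, dotProduct, Fin.sum_univ_two] using this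

theorem IsSolution.hasDerivAt_one (hΦ : p.IsSolution Φ) {x : ℝ} (hx : p.t < x) :
    HasDerivAt (fun x => Φ x 1) (p.coeff x 1 0 * Φ x 0 - p.coeff x 0 0 * Φ x 1) x := by
  have := hasDerivAt_pi.1 (hΦ.ode x hx) 1
  simpa [mulVec, dotProduct, Fin.sum_univ_two, coeff_one_one, sub_eq_add_neg] using this

theorem hasDerivAt_coeff (p : PVIParams) {x : ℝ} (hx : p.t < x) (i j : Fin 2) :
    HasDerivAt (fun x => p.coeff x i j) (∑ ν, -((x - p.pole ν)⁻¹ * (x - p.pole ν)⁻¹) * p.W ν i j)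
      x := by
  simp only [coeff_apply]
  refine HasDerivAt.fun_sum fun ν _ => HasDerivAt.mul_const ?_ _
  have h := ((hasDerivAt_id x).sub_const (p.pole ν)).inv (p.sub_pole_pos hx ν).ne'
  refine h.congr_deriv ?_
  simp only [id]
  field_simp

theorem tendsto_coeff (p : PVIParams) (i j : Fin 2) :
    Tendsto (fun x => p.coeff x i j) atTop (𝓝 0) := by
  simp only [coeff_apply]
  have : Tendsto (fun x => ∑ ν, (x - p.pole ν)⁻¹ * p.W ν i j) atTop
      (𝓝 (∑ ν, 0 * p.W ν i j)) :=
    tendsto_finsetSum _ fun ν _ => Tendsto.mul_const _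
      (tendsto_inv_atTop_zero.comp (tendsto_atTop_add_const_right _ _ tendsto_id))
  simpa using this

theorem kernel_self (p : PVIParams) (Φ : ℝ → Fin 2 → ℝ) (x : ℝ) :
    p.kernel Φ x x = -p.coeff x 1 0 * Φ x 0 ^ 2 + 2 * p.coeff x 0 0 * (Φ x 0 * Φ x 1) +
      p.coeff x 0 1 * Φ x 1 ^ 2 := by
  simp [kernel, J, mulVec, dotProduct, Fin.sum_univ_two, coeff_one_one]
  ring

theorem kernel_of_ne (p : PVIParams) (Φ : ℝ → Fin 2 → ℝ) {x y : ℝ} (h : x ≠ y) :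
    p.kernel Φ x y = (Φ x 0 * Φ y 1 - Φ x 1 * Φ y 0) / (x - y) := by
  simp [kernel, h, J, mulVec, dotProduct, Fin.sum_univ_two]
  ring

/-- `(∂/∂x + ∂/∂y) K(x, y) = - φ(x)† σ φ(y)`. -/
theorem hasDerivAt_kernel_add (hΦ : p.IsSolution Φ) (hV : p.IsFactorization V) {c d w : ℝ}
    (hc : p.t < w + c) (hd : p.t < w + d) :
    HasDerivAt (fun w => p.kernel Φ (w + c) (w + d)) (-p.symbolForm V Φ (w + c) (w + d)) w := by
  have f0 := (hΦ.hasDerivAt_zero hc).comp_add_const w c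
  have f1 := (hΦ.hasDerivAt_one hc).comp_add_const w c
  have g0 := (hΦ.hasDerivAt_zero hd).comp_add_const w d
  have g1 := (hΦ.hasDerivAt_one hd).comp_add_const w d
  rcases eq_or_ne c d with rfl | hcd
  · have hA := (p.hasDerivAt_coeff hc 0 0).comp_add_const w c
    have hB := (p.hasDerivAt_coeff hc 0 1).comp_add_const w c
    have hC := (p.hasDerivAt_coeff hc 1 0).comp_add_const w c
    simp only [kernel_self]
    refine (((hC.neg.mul (f0.pow 2)).add ((hA.const_mul 2).mul (f0.mul f1))).add
      (hB.mul (f1.pow 2))).congr_deriv ?_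
    rw [symbolForm_eq hV]
    simp only [Fin.sum_univ_three, Pi.neg_apply, Pi.mul_apply, Pi.pow_apply]
    push_cast
    ring
  · have hne : ∀ w, w + c ≠ w + d := fun w h => hcd (add_left_cancel h)
    have hsub : w + c - (w + d) ≠ 0 := sub_ne_zero.2 (hne w)
    have hfun : (fun w => p.kernel Φ (w + c) (w + d)) = fun w =>
        (Φ (w + c) 0 * Φ (w + d) 1 - Φ (w + c) 1 * Φ (w + d) 0) / (c - d) := funext fun w => by
      rw [kernel_of_ne p Φ (hne w), add_sub_add_left_eq_sub]
    rw [hfun]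
    refine (((f0.mul g1).sub (f1.mul g0)).div_const (c - d)).congr_deriv ?_
    rw [symbolForm_eq hV, div_eq_iff (sub_ne_zero.2 hcd)]
    simp only [coeff_apply]
    -- The factor `c - d` cancels the denominator of the kernel.
    have hpart : ∀ ν, (w + c - p.pole ν)⁻¹ - (w + d - p.pole ν)⁻¹ =
        -((w + c - p.pole ν)⁻¹ * (w + d - p.pole ν)⁻¹ * (c - d)) := fun ν => by
      have h1 := (p.sub_pole_pos hc ν).ne'
      have h2 := (p.sub_pole_pos hd ν).ne'
      field_simp
      ring
    simp only [Fin.sum_univ_three]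
    have e0 := hpart 0
    have e1 := hpart 1
    have e2 := hpart 2
    generalize (w + c - p.pole 0)⁻¹ = x0 at *
    generalize (w + c - p.pole 1)⁻¹ = x1 at *
    generalize (w + c - p.pole 2)⁻¹ = x2 at *
    generalize (w + d - p.pole 0)⁻¹ = y0 at *
    generalize (w + d - p.pole 1)⁻¹ = y1 at *
    generalize (w + d - p.pole 2)⁻¹ = y2 at *
    linear_combination
      (-p.W 0 1 0 * (Φ (w + c) 0 * Φ (w + d) 0) + p.W 0 0 0 * (Φ (w + c) 0 * Φ (w + d) 1 +
        Φ (w + c) 1 * Φ (w + d) 0) + p.W 0 0 1 * (Φ (w + c) 1 * Φ (w + d) 1)) * e0 +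
      (-p.W 1 1 0 * (Φ (w + c) 0 * Φ (w + d) 0) + p.W 1 0 0 * (Φ (w + c) 0 * Φ (w + d) 1 +
        Φ (w + c) 1 * Φ (w + d) 0) + p.W 1 0 1 * (Φ (w + c) 1 * Φ (w + d) 1)) * e1 +
      (-p.W 2 1 0 * (Φ (w + c) 0 * Φ (w + d) 0) + p.W 2 0 0 * (Φ (w + c) 0 * Φ (w + d) 1 +
        Φ (w + c) 1 * Φ (w + d) 0) + p.W 2 0 1 * (Φ (w + c) 1 * Φ (w + d) 1)) * e2

/-- A function whose derivative vanishes at infinity is slowly varying. -/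
theorem tendsto_sub_shift_of_hasDerivAt {f f' : ℝ → ℝ} {t : ℝ}
    (hf : ∀ x, t < x → HasDerivAt f (f' x) x) (hf' : Tendsto f' atTop (𝓝 0)) (c d : ℝ) :
    Tendsto (fun w => f (w + d) - f (w + c)) atTop (𝓝 0) := by
  rw [Metric.tendsto_nhds]
  intro ε hε
  have hδ : 0 < ε / (|d - c| + 1) := by positivity
  obtain ⟨X, hX⟩ := eventually_atTop.1 ((Metric.tendsto_nhds.1 hf' _ hδ).and
    (eventually_gt_atTop t))
  filter_upwards [eventually_ge_atTop (X - c), eventually_ge_atTop (X - d)] with w hc hd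
  have := (convex_Ici X).norm_image_sub_le_of_norm_hasDerivWithin_le (f := f) (f' := f')
    (C := ε / (|d - c| + 1)) (fun x hx => (hf x (hX x hx).2).hasDerivWithinAt)
    (fun x hx => by simpa using (hX x hx).1.le) (x := w + c) (y := w + d)
    (mem_Ici.2 (by linarith)) (mem_Ici.2 (by linarith))
  rw [dist_zero_right]
  refine this.trans_lt ?_
  rw [add_sub_add_left_eq_sub, Real.norm_eq_abs, div_mul_eq_mul_div, div_lt_iff₀ (by positivity)]
  nlinarith [abs_nonneg (d - c)]

/-- The kernel vanishes at infinity along each line of slope one: off the diagonal, because `Φ`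
is bounded and slowly varying. -/
theorem tendsto_kernel_add (hΦ : p.IsSolution Φ) (c d : ℝ) :
    Tendsto (fun w => p.kernel Φ (w + c) (w + d)) atTop (𝓝 0) := by
  obtain ⟨M, hM⟩ := hΦ.bounded
  have hb : ∀ i, IsBoundedUnder (· ≤ ·) atTop fun x => ‖Φ x i‖ := fun i =>
    ⟨M, eventually_map.2 ((eventually_gt_atTop p.t).mono fun x hx =>
      (norm_le_pi_norm (Φ x) i).trans (hM x hx))⟩
  have hbs : ∀ e i, IsBoundedUnder (· ≤ ·) atTop fun w => ‖Φ (w + e) i‖ := fun e i =>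
    ⟨M, eventually_map.2 ((eventually_gt_atTop (p.t - e)).mono fun x hx =>
      (norm_le_pi_norm (Φ (x + e)) i).trans (hM _ (by linarith)))⟩
  rcases eq_or_ne c d with rfl | hcd
  · simp only [kernel_self]
    have hsh : ∀ i j, Tendsto (fun w => p.coeff (w + c) i j) atTop (𝓝 0) := fun i j =>
      (p.tendsto_coeff i j).comp (tendsto_atTop_add_const_right _ _ tendsto_id)
    have hz : ∀ i j k l, Tendsto (fun w => p.coeff (w + c) i j * Φ (w + c) k * Φ (w + c) l) atTop
        (𝓝 0) := fun i j k l =>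
      ((hsh i j).zero_mul_isBoundedUnder_le (hbs c k)).zero_mul_isBoundedUnder_le (hbs c l)
    have := (((hz 1 0 0 0).neg).add ((hz 0 0 0 1).const_mul 2)).add (hz 0 1 1 1)
    simp only [neg_zero, mul_zero, add_zero] at this
    refine this.congr fun w => ?_
    ring
  · have hne : ∀ w, w + c ≠ w + d := fun w h => hcd (add_left_cancel h)
    -- `K = (Φ₀ (Ψ₁ - Φ₁) - Φ₁ (Ψ₀ - Φ₀)) / (c - d)` for `Φ`, `Ψ` at `w + c`, `w + d`.
    have h0 : Tendsto (fun w => Φ (w + d) 0 - Φ (w + c) 0) atTop (𝓝 0) :=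
      tendsto_sub_shift_of_hasDerivAt (f := fun x => Φ x 0) (fun x hx => hΦ.hasDerivAt_zero hx) (by
        simpa using ((p.tendsto_coeff 0 0).zero_mul_isBoundedUnder_le (hb 0)).add
          ((p.tendsto_coeff 0 1).zero_mul_isBoundedUnder_le (hb 1))) c d
    have h1 : Tendsto (fun w => Φ (w + d) 1 - Φ (w + c) 1) atTop (𝓝 0) :=
      tendsto_sub_shift_of_hasDerivAt (f := fun x => Φ x 1) (fun x hx => hΦ.hasDerivAt_one hx) (by
        simpa using ((p.tendsto_coeff 1 0).zero_mul_isBoundedUnder_le (hb 0)).sub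
          ((p.tendsto_coeff 0 0).zero_mul_isBoundedUnder_le (hb 1))) c d
    have := ((h1.zero_mul_isBoundedUnder_le (hbs c 0)).sub
      (h0.zero_mul_isBoundedUnder_le (hbs c 1))).div_const (c - d)
    simp only [sub_zero, zero_div] at this
    refine this.congr fun w => ?_
    rw [kernel_of_ne p Φ (hne w), add_sub_add_left_eq_sub]
    ring

/-- `K(x + c, x + d) = ∫_x^∞ φ(w + c)† σ φ(w + d) dw`. -/
theorem kernel_eq_integral (hΦ : p.IsSolution Φ) (hV : p.IsFactorization V) {x c d : ℝ}
    (hc : p.t < x + c) (hd : p.t < x + d)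
    (hint : IntegrableOn (fun w => p.symbolForm V Φ (w + c) (w + d)) (Ioi x)) :
    p.kernel Φ (x + c) (x + d) = ∫ w in Ioi x, p.symbolForm V Φ (w + c) (w + d) := by
  have := integral_Ioi_of_hasDerivAt_of_tendsto' (a := x)
    (fun w hw => hasDerivAt_kernel_add (w := w) hΦ hV
      (hc.trans_le (add_le_add_left (mem_Ici.1 hw) c))
      (hd.trans_le (add_le_add_left (mem_Ici.1 hw) d))) hint.neg (tendsto_kernel_add hΦ c d)
  rw [integral_neg] at this
  linarith

end PVIParams

/-! ### The Gelfand–Levitan equation -/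

section Entries

variable (M : Matrix ((Fin 3 ⊕ Fin 3) ⊕ Unit) ((Fin 3 ⊕ Fin 3) ⊕ Unit) ℂ) (f : Fin 3 ⊕ Fin 3 → ℝ)

theorem offDiag_inl_inl (i j : Fin 3 ⊕ Fin 3) :
    _root_.offDiag f (Sum.inl i) (Sum.inl j) = 0 := rfl

theorem offDiag_inl_inr (i : Fin 3 ⊕ Fin 3) (u : Unit) :
    _root_.offDiag f (Sum.inl i) (Sum.inr u) = f i := rfl

theorem offDiag_inr_inl (u : Unit) (j : Fin 3 ⊕ Fin 3) :
    _root_.offDiag f (Sum.inr u) (Sum.inl j) = f j := Complex.conj_ofReal _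

theorem offDiag_inr_inr (u v : Unit) : _root_.offDiag f (Sum.inr u) (Sum.inr v) = 0 := rfl

theorem starProd_inl_inl (i j : Fin 3 ⊕ Fin 3) :
    starProd M (_root_.offDiag f) (Sum.inl i) (Sum.inl j) =
      M (Sum.inl i) (Sum.inr ()) * f j * sign33 j := by
  rw [starProd, fromBlocks_apply₁₁, sigma33_eq_diagonal, mul_diagonal, mul_apply,
    Fintype.sum_unique]
  simp only [toBlocks₁₂, toBlocks₂₁, of_apply, offDiag_inr_inl]

theorem starProd_inl_inr (i : Fin 3 ⊕ Fin 3) (u : Unit) :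
    starProd M (_root_.offDiag f) (Sum.inl i) (Sum.inr u) =
      ∑ l, M (Sum.inl i) (Sum.inl l) * f l := rfl

theorem starProd_inr_inl (u : Unit) (j : Fin 3 ⊕ Fin 3) :
    starProd M (_root_.offDiag f) (Sum.inr u) (Sum.inl j) =
      M (Sum.inr u) (Sum.inr ()) * f j := by
  rw [starProd, fromBlocks_apply₂₁, mul_apply, Fintype.sum_unique]
  simp only [toBlocks₂₂, toBlocks₂₁, of_apply, offDiag_inr_inl]

theorem starProd_inr_inr (u v : Unit) :
    starProd M (_root_.offDiag f) (Sum.inr u) (Sum.inr v) =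
      ∑ l, M (Sum.inr u) (Sum.inl l) * sign33 l * f l := by
  rw [starProd, fromBlocks_apply₂₂, sigma33_eq_diagonal, mul_apply]
  simp only [mul_diagonal]
  rfl

end Entries

namespace LinearSystem

variable {a : ℝ} {H : Type*} [NormedAddCommGroup H] [InnerProductSpace ℂ H] [CompleteSpace H]
  {sys : LinearSystem a H} {L Q : ℝ → H →L[ℂ] H} {φ : ℝ → Fin 3 ⊕ Fin 3 → ℝ}

theorem Realises.inner_rowC (hφ : sys.Realises φ) {x y : ℝ} (hx : a < x) (hy : a < y)
    (i : Fin 3 ⊕ Fin 3) : ⟪sys.rowC x i, sys.expAB y⟫_ℂ = (φ (x + y) i : ℂ) := by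
  rw [LinearSystem.inner_rowC, hφ x y hx hy]

theorem Realises.inner_rowC_right (hφ : sys.Realises φ) {x y : ℝ} (hx : a < x) (hy : a < y)
    (i : Fin 3 ⊕ Fin 3) : ⟪sys.expAB y, sys.rowC x i⟫_ℂ = (φ (x + y) i : ℂ) := by
  rw [LinearSystem.inner_rowC_right, hφ x y hx hy, Complex.conj_ofReal]

omit [CompleteSpace H] in
theorem IsL.integral_eq {x : ℝ} {M : H →L[ℂ] H} (hM : sys.IsL x M) (c : ℂ) (h k : H) :
    IntegrableOn (fun s => c * (⟪k, sys.expAB s⟫_ℂ * ⟪sys.expAB s, h⟫_ℂ)) (Ioi x) ∧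
      ∫ s in Ioi x, c * (⟪k, sys.expAB s⟫_ℂ * ⟪sys.expAB s, h⟫_ℂ) = c * ⟪k, M h⟫_ℂ :=
  ⟨(hM.inner_eq h k).1.const_mul c, by rw [integral_const_mul, (hM.inner_eq h k).2]⟩

theorem IsQsigma.integral_eq {x : ℝ} {M : H →L[ℂ] H} (hM : sys.IsQsigma x M) (c : ℂ) (h k : H) :
    IntegrableOn (fun s => c * ⟪k, sys.densityQ s h⟫_ℂ) (Ioi x) ∧
      ∫ s in Ioi x, c * ⟪k, sys.densityQ s h⟫_ℂ = c * ⟪k, M h⟫_ℂ := by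
  have := hM h k
  exact ⟨this.1.const_mul c, by rw [integral_const_mul, this.2]; rfl⟩

theorem G_inl_inl (sys : LinearSystem a H) (x y : ℝ) (i j : Fin 3 ⊕ Fin 3) :
    sys.G L Q x y (Sum.inl i) (Sum.inl j) =
      ⟪sys.rowC x i, Ring.inverse (1 - L x * Q x) (L x (sys.rowC y j))⟫_ℂ * sign33 j := by
  rw [G, fromBlocks_apply₁₁, sigma33_eq_diagonal, mul_diagonal, of_apply,
    LinearSystem.inner_rowC]
  rfl

theorem G_inl_inr (sys : LinearSystem a H) (x y : ℝ) (i : Fin 3 ⊕ Fin 3) (u : Unit) :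
    sys.G L Q x y (Sum.inl i) (Sum.inr u) =
      -⟪sys.rowC x i, Ring.inverse (1 - L x * Q x) (sys.expAB y)⟫_ℂ := by
  rw [G, fromBlocks_apply₁₂, of_apply, LinearSystem.inner_rowC]

theorem G_inr_inl (sys : LinearSystem a H) (x y : ℝ) (u : Unit) (j : Fin 3 ⊕ Fin 3) :
    sys.G L Q x y (Sum.inr u) (Sum.inl j) =
      -⟪sys.expAB x, Ring.inverse (1 - Q x * L x) (sys.rowC y j)⟫_ℂ := by
  rw [G, fromBlocks_apply₂₁, of_apply]
  rfl

theorem G_inr_inr (sys : LinearSystem a H) (x y : ℝ) (u v : Unit) :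
    sys.G L Q x y (Sum.inr u) (Sum.inr v) =
      ⟪sys.expAB x, Ring.inverse (1 - Q x * L x) (Q x (sys.expAB y))⟫_ℂ := by
  rw [G, fromBlocks_apply₂₂, of_apply]

/-- Each entry of the integral is a matrix entry of `L_x = ∫ b b†` or of `Q_x^σ`, since the factors
`φ(w + y)` are inner products of `b = e^{-wA} B` or of the rows of `C e^{-wA}` with fixed vectors.
The equation then reduces to `N = I + N L Q` and `N' = I + N' Q L` for the two resolvents. -/
theorem gelfandLevitanAt (hφ : sys.Realises φ) {x y : ℝ} (hx : a < x) (hy : a < y)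
    (hL : sys.IsL x (L x)) (hQ : sys.IsQsigma x (Q x))
    (hu : IsUnit (1 - L x * Q x)) (hu' : IsUnit (1 - Q x * L x)) :
    GelfandLevitanAt φ (sys.G L Q) x y := by
  set N := Ring.inverse (1 - L x * Q x) with hN
  set N' := Ring.inverse (1 - Q x * L x) with hN'
  have hN1 : ∀ h, N h = h + N (L x (Q x h)) := fun h => by
    have := inverse_eq_one_add_mul' (c := 1) (Z := L x * Q x) (by simpa using hu)
    rw [one_smul, one_smul, ← hN] at this
    simpa using congrArg (fun T => T h) this
  have hN1' : ∀ h, N' h = h + N' (Q x (L x h)) := fun h => by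
    have := inverse_eq_one_add_mul' (c := 1) (Z := Q x * L x) (by simpa using hu')
    rw [one_smul, one_smul, ← hN'] at this
    simpa using congrArg (fun T => T h) this
  have key : ∀ (f g : ℝ → ℂ) (A B : ℂ), (∀ w ∈ Ioi x, g w = f w) →
      (IntegrableOn g (Ioi x) ∧ ∫ w in Ioi x, g w = B) → A + B = 0 →
      IntegrableOn f (Ioi x) ∧ A + ∫ w in Ioi x, f w = 0 := by
    rintro f g A B hfg ⟨h1, h2⟩ h3
    exact ⟨h1.congr_fun hfg measurableSet_Ioi, by
      rw [← setIntegral_congr_fun measurableSet_Ioi hfg, h2, h3]⟩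
  have hxw : ∀ w ∈ Ioi x, a < w := fun w hw => hx.trans hw
  rintro (i | i) (j | j)
  · refine key _ _ _ _ (fun w hw => ?_) (hL.integral_eq (-sign33 j) (sys.rowC y j)
      (ContinuousLinearMap.adjoint N (sys.rowC x i))) ?_
    · rw [starProd_inl_inl, G_inl_inr, hφ.inner_rowC_right hy (hxw w hw),
        ContinuousLinearMap.adjoint_inner_left, add_comm y w]
      ring
    · rw [ContinuousLinearMap.adjoint_inner_left, G_inl_inl, offDiag_inl_inl]
      ring
  · refine key _ _ _ _ (fun w hw => ?_) (hQ.integral_eq 1 (sys.expAB y)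
      (ContinuousLinearMap.adjoint (L x) (ContinuousLinearMap.adjoint N (sys.rowC x i)))) ?_
    · rw [inner_densityQ, starProd_inl_inr, one_mul]
      refine Finset.sum_congr rfl fun l _ => ?_
      rw [hφ.inner_rowC (hxw w hw) hy, ContinuousLinearMap.adjoint_inner_left,
        ContinuousLinearMap.adjoint_inner_left, G_inl_inl]
      ring
    · rw [ContinuousLinearMap.adjoint_inner_left, ContinuousLinearMap.adjoint_inner_left, one_mul,
        offDiag_inl_inr, ← hφ.inner_rowC hx hy, G_inl_inr, ← hN, hN1 (sys.expAB y),
        inner_add_right]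
      ring
  · refine key _ _ _ _ (fun w hw => ?_) (hL.integral_eq 1 (sys.rowC y j)
      (ContinuousLinearMap.adjoint (Q x) (ContinuousLinearMap.adjoint N' (sys.expAB x)))) ?_
    · rw [starProd_inr_inl, G_inr_inr, hφ.inner_rowC_right hy (hxw w hw),
        ContinuousLinearMap.adjoint_inner_left, ContinuousLinearMap.adjoint_inner_left,
        add_comm y w, one_mul]
    · rw [ContinuousLinearMap.adjoint_inner_left, ContinuousLinearMap.adjoint_inner_left, one_mul,
        offDiag_inr_inl, add_comm x y, ← hφ.inner_rowC_right hy hx, G_inr_inl, ← hN',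
        hN1' (sys.rowC y j), inner_add_right]
      ring
  · refine key _ _ _ _ (fun w hw => ?_) (hQ.integral_eq (-1) (sys.expAB y)
      (ContinuousLinearMap.adjoint N' (sys.expAB x))) ?_
    · rw [inner_densityQ, starProd_inr_inr, neg_one_mul, ← Finset.sum_neg_distrib]
      refine Finset.sum_congr rfl fun l _ => ?_
      rw [hφ.inner_rowC (hxw w hw) hy, ContinuousLinearMap.adjoint_inner_left, G_inr_inl]
      ring
    · rw [ContinuousLinearMap.adjoint_inner_left, G_inr_inr, offDiag_inr_inr]
      ring

end LinearSystem

/-! ### The tau function as a Fredholm determinant on the state space -/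

section Tau

theorem measurePreserving_sub_Ioi (x : ℝ) :
    MeasurePreserving (fun l : ℝ => l - x) (volume.restrict (Ioi (2 * x)))
      (volume.restrict (Ioi x)) := by
  have h := (measurePreserving_sub_right volume x).restrict_preimage (s := Ioi x) measurableSet_Ioi
  have he : (fun l : ℝ => l - x) ⁻¹' Ioi x = Ioi (2 * x) := by
    ext l
    simp only [mem_preimage, mem_Ioi]
    constructor <;> intro h <;> linarith
  rwa [he] at h

theorem integral_sub_Ioi {E : Type*} [NormedAddCommGroup E] [NormedSpace ℝ E] (f : ℝ → E) (x : ℝ) :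
    ∫ l in Ioi (2 * x), f (l - x) = ∫ s in Ioi x, f s :=
  (measurePreserving_sub_Ioi x).integral_comp
    (MeasurableEquiv.subRight x).measurableEmbedding f

variable {H : Type*} [NormedAddCommGroup H] [InnerProductSpace ℂ H]
  {k : ℝ → ℝ → ℝ} {b : ℝ → H} {Q : H →L[ℂ] H} {X : Set ℝ}

/-- Only almost everywhere, because `k` is given by inner products on `X` alone. -/
theorem ofReal_fredholmMinor_ae (hX : MeasurableSet X)
    (hk : ∀ l ∈ X, ∀ m ∈ X, (k l m : ℂ) = ⟪b l, Q (b m)⟫_ℂ) (n : ℕ) :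
    (fun s : Fin n → ℝ => gramMinor b Q s) =ᵐ[powMeasure X n] fun s => (fredholmMinor k s : ℂ) := by
  have hmem : ∀ᵐ s ∂powMeasure X n, ∀ i, s i ∈ X := by
    rw [Filter.eventually_all]
    exact fun i => (Measure.quasiMeasurePreserving_eval (fun _ : Fin n => volume.restrict X) i).ae
      (ae_restrict_mem hX)
  filter_upwards [hmem] with s hs
  rw [gramMinor, fredholmMinor, ← Complex.ofRealHom_eq_coe, RingHom.map_det]
  congr 1
  ext i j
  simp [hk _ (hs i) _ (hs j)]

theorem fredholmConverges_of_inner (hX : MeasurableSet X)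
    (hk : ∀ l ∈ X, ∀ m ∈ X, (k l m : ℂ) = ⟪b l, Q (b m)⟫_ℂ)
    (hb : AEStronglyMeasurable b (volume.restrict X))
    (hb2 : IntegrableOn (fun s => ‖b s‖ ^ 2) X) : FredholmConverges k X := by
  have hae := ofReal_fredholmMinor_ae hX hk
  refine ⟨fun n => ?_, ?_⟩
  · have := ((integrable_gramMinor (Q := Q) hb hb2 n).congr (hae n)).re
    simp only [RCLike.re_to_complex, Complex.ofReal_re] at this
    exact this
  · refine (Real.summable_pow_div_factorial (‖Q‖ * ∫ s in X, ‖b s‖ ^ 2)).of_nonneg_of_le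
      (fun n => mul_nonneg (by positivity) (integral_nonneg fun s => abs_nonneg _)) fun n => ?_
    rw [div_eq_inv_mul]
    gcongr
    refine le_of_eq_of_le (integral_congr_ae ?_) (integral_norm_gramMinor_le hb hb2 n)
    filter_upwards [hae n] with s hs
    rw [hs, Complex.norm_real, Real.norm_eq_abs]

theorem ofReal_fredholmDet (hX : MeasurableSet X)
    (hk : ∀ l ∈ X, ∀ m ∈ X, (k l m : ℂ) = ⟪b l, Q (b m)⟫_ℂ) :
    (fredholmDet k X : ℂ) = gramDet (volume.restrict X) b Q 1 := by
  rw [fredholmDet, gramDet, Complex.ofReal_tsum]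
  refine tsum_congr fun n => ?_
  have hI : gramCoeff (volume.restrict X) b Q n =
      ((∫ s, fredholmMinor k s ∂powMeasure X n : ℝ) : ℂ) := by
    rw [← integral_complex_ofReal]
    exact integral_congr_ae (ofReal_fredholmMinor_ae hX hk n)
  rw [hI, fredholmWeight, ← Complex.ofReal_mul, div_eq_mul_inv]

end Tau

namespace LinearSystem

variable {a : ℝ} {H : Type*} [NormedAddCommGroup H] [InnerProductSpace ℂ H] [CompleteSpace H]
  {sys : LinearSystem a H} {L Q : ℝ → H →L[ℂ] H} {p : PVIParams} {Φ : ℝ → Fin 2 → ℝ}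
  {V : Fin 3 → Matrix (Fin 2) (Fin 2) ℝ}

/-- The kernel factors through `Q_x^σ`: `K(l, m) = ⟨e^{-(l-x)A} B, Q_x^σ e^{-(m-x)A} B⟩`. -/
theorem kernel_eq_inner (hΦ : p.IsSolution Φ) (hV : p.IsFactorization V) (ha : p.t / 2 ≤ a)
    (hsys : sys.Realises (p.symbol V Φ)) {x : ℝ} (hx : a < x) {M : H →L[ℂ] H}
    (hM : sys.IsQsigma x M) {l m : ℝ} (hl : 2 * x < l) (hm : 2 * x < m) :
    (p.kernel Φ l m : ℂ) = ⟪sys.expAB (l - x), M (sys.expAB (m - x))⟫_ℂ := by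
  have hc : a < l - x := by linarith
  have hd : a < m - x := by linarith
  obtain ⟨h1, h2⟩ := hM (sys.expAB (m - x)) (sys.expAB (l - x))
  have hform : ∀ w ∈ Ioi x, ⟪sys.expAB (l - x), sys.densityQ w (sys.expAB (m - x))⟫_ℂ =
      (p.symbolForm V Φ (w + (l - x)) (w + (m - x)) : ℂ) := fun w hw => by
    have haw : a < w := hx.trans hw
    rw [inner_densityQ, PVIParams.symbolForm, Fintype.sum_sum_type]
    simp only [hsys.inner_rowC haw hd, hsys.inner_rowC_right haw hc, sign33, Sum.elim_inl,
      Sum.elim_inr, Finset.sum_sub_distrib, Complex.ofReal_sub, Complex.ofReal_sum,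
      Complex.ofReal_mul, one_mul, neg_one_mul, Finset.sum_neg_distrib]
    exact (sub_eq_add_neg _ _).symm
  have hint : IntegrableOn (fun w => p.symbolForm V Φ (w + (l - x)) (w + (m - x))) (Ioi x) := by
    have := (h1.congr_fun hform measurableSet_Ioi).re
    simp only [RCLike.re_to_complex, Complex.ofReal_re] at this
    exact this
  have hker := PVIParams.kernel_eq_integral hΦ hV (x := x) (c := l - x) (d := m - x)
    (by linarith) (by linarith) hint
  rw [add_sub_cancel, add_sub_cancel] at hker
  rw [hker, h2, ← integral_complex_ofReal]
  exact (setIntegral_congr_fun measurableSet_Ioi hform).symm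

/-- The trace of `L Q (I - t L Q)⁻¹` is real, since `Q (I - t L Q)⁻¹` is self-adjoint. -/
theorem conj_gramTrace_resolvent {α : Type*} [MeasurableSpace α] {μ : Measure α} {b : α → H}
    {L Q : H →L[ℂ] H} (hL : ContinuousLinearMap.adjoint L = L)
    (hQ : ContinuousLinearMap.adjoint Q = Q) (hLQ : ‖L * Q‖ < 1) (hQL : ‖Q * L‖ < 1) {t : ℝ}
    (ht : t ∈ Icc (0 : ℝ) 1) :
    (starRingEnd ℂ) (gramTrace μ b (Q * Ring.inverse (1 - (t : ℂ) • (L * Q)))) =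
      gramTrace μ b (Q * Ring.inverse (1 - (t : ℂ) • (L * Q))) := by
  have hadj : ContinuousLinearMap.adjoint (Q * Ring.inverse (1 - (t : ℂ) • (L * Q))) =
      Q * Ring.inverse (1 - (t : ℂ) • (L * Q)) := by
    rw [← ContinuousLinearMap.star_eq_adjoint] at hL hQ ⊢
    rw [star_mul, ← Ring.inverse_star, star_sub, star_one, star_smul, star_mul, hL, hQ,
      mul_inverse_one_sub_comm (isUnit_one_sub_smul hLQ ht) (isUnit_one_sub_smul hQL ht)]
    simp
  rw [gramTrace, ← integral_conj]
  refine integral_congr_ae (Filter.Eventually.of_forall fun s => ?_)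
  simp only
  rw [inner_conj_symm, ← ContinuousLinearMap.adjoint_inner_right, hadj]

/-- `tr G(x, x)`, where the block `ζ` is rewritten by `(I - Q L)⁻¹ Q = Q (I - L Q)⁻¹`. -/
theorem trace_G (sys : LinearSystem a H) {x : ℝ} (hu : IsUnit (1 - L x * Q x))
    (hu' : IsUnit (1 - Q x * L x)) :
    Matrix.trace (sys.G L Q x x) =
      ⟪sys.expAB x, Q x (Ring.inverse (1 - L x * Q x) (sys.expAB x))⟫_ℂ +
        ∑ i, sign33 i * ⟪sys.rowC x i, Ring.inverse (1 - L x * Q x) (L x (sys.rowC x i))⟫_ℂ := by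
  have h := mul_inverse_one_sub_comm (L := L x) (Q := Q x) (c := 1) (by simpa using hu)
    (by simpa using hu')
  rw [one_smul, one_smul] at h
  have h' : Q x (Ring.inverse (1 - L x * Q x) (sys.expAB x)) =
      Ring.inverse (1 - Q x * L x) (Q x (sys.expAB x)) := congrArg (fun T => T (sys.expAB x)) h
  rw [Matrix.trace, Fintype.sum_sum_type, add_comm]
  simp only [diag_apply, G_inl_inl, G_inr_inr, h', mul_comm,
    Finset.univ_unique, Finset.sum_singleton]

/-- `τ_K(2x) = exp (- ∫₀¹ tr (L_x Q_x (I - t L_x Q_x)⁻¹) dt)`. -/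
theorem ofReal_tau {x : ℝ} (hL : sys.IsL x (L x)) (hQ : sys.IsQsigma x (Q x))
    (hΦ : p.IsSolution Φ) (hV : p.IsFactorization V) (ha : p.t / 2 ≤ a)
    (hsys : sys.Realises (p.symbol V Φ)) (hx : a < x)
    (hb2 : IntegrableOn (fun s => ‖sys.expAB s‖ ^ 2) (Ioi x))
    (hLQ : ‖L x * Q x‖ < 1) :
    FredholmConverges (p.kernel Φ) (Ioi (2 * x)) ∧
      (p.tau Φ (2 * x) : ℂ) = Complex.exp (-∫ t in (0 : ℝ)..1,
        gramTrace (volume.restrict (Ioi x)) sys.expAB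
          (Q x * Ring.inverse (1 - (t : ℂ) • (L x * Q x)))) := by
  have hb : AEStronglyMeasurable (fun l => sys.expAB (l - x)) (volume.restrict (Ioi (2 * x))) :=
    (sys.aestronglyMeasurable_expAB hx).comp_measurePreserving
      (measurePreserving_sub_Ioi x)
  have hb2' : IntegrableOn (fun l => ‖sys.expAB (l - x)‖ ^ 2) (Ioi (2 * x)) :=
    (measurePreserving_sub_Ioi x).integrable_comp_of_integrable hb2
  have hk : ∀ l ∈ Ioi (2 * x), ∀ m ∈ Ioi (2 * x),
      (p.kernel Φ l m : ℂ) = ⟪sys.expAB (l - x), Q x (sys.expAB (m - x))⟫_ℂ := fun l hl m hm =>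
    kernel_eq_inner hΦ hV ha hsys hx hQ hl hm
  refine ⟨fredholmConverges_of_inner measurableSet_Ioi hk hb hb2', ?_⟩
  rw [PVIParams.tau, ofReal_fredholmDet measurableSet_Ioi hk,
    gramDet_one_eq_exp hb hb2' (fun h k => ?_) hLQ]
  · simp only [gramTrace]
    congr 2
    refine intervalIntegral.integral_congr fun t _ => ?_
    exact integral_sub_Ioi (fun s => ⟪sys.expAB s,
      (Q x * Ring.inverse (1 - (t : ℂ) • (L x * Q x))) (sys.expAB s)⟫_ℂ) x
  · rw [(hL.inner_eq h k).2]
    exact (integral_sub_Ioi (fun s => ⟪k, sys.expAB s⟫_ℂ * ⟪sys.expAB s, h⟫_ℂ) x).symm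

/-- The exponent in the formula for `τ_K(2x)` is real. -/
theorem tau_pos_and_log {x : ℝ} (hL : sys.IsL x (L x)) (hQ : sys.IsQsigma x (Q x))
    (hΦ : p.IsSolution Φ) (hV : p.IsFactorization V) (ha : p.t / 2 ≤ a)
    (hsys : sys.Realises (p.symbol V Φ)) (hx : a < x)
    (hb2 : IntegrableOn (fun s => ‖sys.expAB s‖ ^ 2) (Ioi x))
    (hLQ : ‖L x * Q x‖ < 1) (hQL : ‖Q x * L x‖ < 1) :
    0 < p.tau Φ (2 * x) ∧ ((Real.log (p.tau Φ (2 * x)) : ℝ) : ℂ) = -∫ t in (0 : ℝ)..1,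
        gramTrace (volume.restrict (Ioi x)) sys.expAB
          (Q x * Ring.inverse (1 - (t : ℂ) • (L x * Q x))) := by
  have htau := (ofReal_tau hL hQ hΦ hV ha hsys hx hb2 hLQ).2
  set I := ∫ t in (0 : ℝ)..1, gramTrace (volume.restrict (Ioi x)) sys.expAB
    (Q x * Ring.inverse (1 - (t : ℂ) • (L x * Q x))) with hI
  have hreal : (starRingEnd ℂ) I = I := by
    rw [hI, intervalIntegral.integral_of_le zero_le_one, ← integral_conj]
    exact setIntegral_congr_fun measurableSet_Ioc fun t ht =>
      conj_gramTrace_resolvent hL.adjoint_eq hQ.adjoint_eq hLQ hQL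
        (Ioc_subset_Icc_self ht)
  obtain ⟨r, hr⟩ := Complex.conj_eq_iff_real.1 hreal
  rw [hr, ← Complex.ofReal_neg, ← Complex.ofReal_exp, Complex.ofReal_inj] at htau
  rw [htau, Real.log_exp, hr, Complex.ofReal_neg]
  exact ⟨Real.exp_pos _, rfl⟩

end LinearSystem

end

theorem theorem4p1 {H : Type*} [NormedAddCommGroup H] [InnerProductSpace ℂ H] [CompleteSpace H]
    [TopologicalSpace.SeparableSpace H]
    (p : PVIParams) (Φ : ℝ → Fin 2 → ℝ) (hΦ : p.IsSolution Φ)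
    (V : Fin 3 → Matrix (Fin 2) (Fin 2) ℝ) (hV : p.IsFactorization V)
    (a : ℝ) (ha : p.t / 2 ≤ a)
    (sys : LinearSystem a H) (hsys : sys.Realises (p.symbol V Φ))
    (L Q : ℝ → H →L[ℂ] H)
    (hL : ∀ x, a < x → sys.IsL x (L x) ∧ IsTraceClass (L x) ∧ ‖L x‖ < 1)
    (hQ : ∀ x, a < x → sys.IsQsigma x (Q x) ∧ IsTraceClass (Q x) ∧ ‖Q x‖ < 1) :
    (∀ x, a < x → IsUnit (1 - L x * Q x) ∧ IsUnit (1 - Q x * L x)) ∧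
    (∀ x y, a < x → a < y → GelfandLevitanAt (p.symbol V Φ) (sys.G L Q) x y) ∧
    (∀ x, a < x → FredholmConverges (p.kernel Φ) (Ioi (2 * x)) ∧ 0 < p.tau Φ (2 * x) ∧
      HasDerivAt (fun s : ℝ => ((Real.log (p.tau Φ (2 * s)) : ℝ) : ℂ))
        (Matrix.trace (sys.G L Q x x)) x) := by
  have hLQ : ∀ x, a < x → ‖L x * Q x‖ < 1 := fun x hx => (norm_mul_le _ _).trans_lt
    (mul_lt_one_of_nonneg_of_lt_one_left (norm_nonneg _) (hL x hx).2.2 (hQ x hx).2.2.le)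
  have hQL : ∀ x, a < x → ‖Q x * L x‖ < 1 := fun x hx => (norm_mul_le _ _).trans_lt
    (mul_lt_one_of_nonneg_of_lt_one_left (norm_nonneg _) (hQ x hx).2.2 (hL x hx).2.2.le)
  have hu : ∀ x, a < x → IsUnit (1 - L x * Q x) := fun x hx =>
    isUnit_one_sub_of_norm_lt_one (hLQ x hx)
  have hu' : ∀ x, a < x → IsUnit (1 - Q x * L x) := fun x hx =>
    isUnit_one_sub_of_norm_lt_one (hQL x hx)
  have hL1 : ∀ x, a < x → sys.IsL x (L x) := fun x hx => (hL x hx).1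
  have hQ1 : ∀ x, a < x → sys.IsQsigma x (Q x) := fun x hx => (hQ x hx).1
  have hb2 : ∀ x, a < x → IntegrableOn (fun s => ‖sys.expAB s‖ ^ 2) (Ioi x) := fun x hx =>
    (hL1 x hx).integrableOn_norm_sq hx (hL x hx).2.1
  refine ⟨fun x hx => ⟨hu x hx, hu' x hx⟩, fun x y hx hy =>
    LinearSystem.gelfandLevitanAt hsys hx hy (hL1 x hx) (hQ1 x hx) (hu x hx) (hu' x hx),
    fun x hx => ?_⟩
  have hlog := fun y (hy : a < y) =>
    LinearSystem.tau_pos_and_log (hL1 y hy) (hQ1 y hy) hΦ hV ha hsys hy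
      (hb2 y hy) (hLQ y hy) (hQL y hy)
  refine ⟨(LinearSystem.ofReal_tau (hL1 x hx) (hQ1 x hx) hΦ hV ha hsys hx (hb2 x hx) (hLQ x hx)).1,
    (hlog x hx).1, ?_⟩
  have hd := (LinearSystem.hasDerivAt_integral_gramTrace_resolvent hL1 hQ1 hb2 hLQ hx).neg
  rw [neg_neg, ← sys.trace_G (hu x hx) (hu' x hx)] at hd
  exact hd.congr_of_eventuallyEq (Filter.eventually_of_mem (Ioi_mem_nhds hx) fun y hy =>
    (hlog y hy).2)
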